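/- Let $B=\operatorname{diag}(b_1,\dots,b_n)$ with $b_1,\dots,b_n\in\mathbb C\setminus\{0\}$, and let $\mathfrak H=L^2([0,1];\mathbb C^n)$. For a potential $Q\in L^1([0,1];\mathbb C^{n\times n})$ put $L(Q)y=-iB^{-1}y'+Q(x)y$, and for $C,D\in\mathbb C^{n\times n}$ with $\operatorname{rank}\begin{pmatrix}C & D\end{pmatrix}=n$ let $L_{C,D}(Q)$ be the operator $y\mapsto L(Q)y$ in $\mathfrak H$ with domain $$\{\,y\in W^{1,1}([0,1];\mathbb C^n): L(Q)y\in\mathfrak H,\ Cy(0)+Dy(1)=0\,\}.$$ Let $Q_1,Q_2\in L^1([0,1];\mathbb C^{n\times n})$, let $C_1,D_1,C_2,D_2\in\mathbb C^{n\times n}$ satisfy $\operatorname{rank}\begin{pmatrix}C_j & D_j\end{pmatrix}=n$, $j\in\{1,2\}$, and let $\lambda$ belong to the resolvent sets of both $L_{C_1,D_1}(Q_1)$ and $L_{C_2,D_2}(Q_2)$. Then the difference $$(L_{C_1,D_1}(Q_1)-\lambda)^{-1}-(L_{C_2,D_2}(Q_2)-\lambda)^{-1}$$ is a trace class operator in $\mathfrak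 H$. Moreover, the equations $L(Q_j)y=\lambda y$ have fundamental matrices $\Phi_j(\cdot,\lambda)$ on $[0,1]$ with entries in $W^{1,1}[0,1]$ and $\Phi_j(0,\lambda)=I_n$; the matrices $\Phi_j(x,\lambda)$, $x\in[0,1]$, and $C_j+D_j\Phi_j(1,\lambda)$ are invertible, $j\in\{1,2\}$; and, the integral being convergent, $$\operatorname{tr}\bigl((L_{C_1,D_1}(Q_1)-\lambda)^{-1}-(L_{C_2,D_2}(Q_2)-\lambda)^{-1}\bigr)$$ $$=\operatorname{tr}\int_0^1\Bigl(\Phi_1(x,\lambda)(C_1+D_1\Phi_1(1,\lambda))^{-1}C_1\Phi_1(x,\lambda)^{-1}-\Phi_2(x,\lambda)(C_2+D_2\Phi_2(1,\lambda))^{-1}C_2\Phi_2(x,\lambda)^{-1}\Bigr)iB\,dx .$$ -/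

import Mathlib

open MeasureTheory Set
open scoped InnerProductSpace Matrix

namespace DiracBVP

section Abstract

universe u

variable {H : Type u} [NormedAddCommGroup H] [InnerProductSpace ℂ H]

/-- `R` is the (everywhere defined, bounded) resolvent `(T - z)⁻¹` of the unbounded operator `T`. -/
def IsResolventAt (T : H →ₗ.[ℂ] H) (z : ℂ) (R : H →L[ℂ] H) : Prop :=
  (∀ f : H, ∃ hf : R f ∈ T.domain, T ⟨R f, hf⟩ - z • R f = f) ∧
    ∀ y : T.domain, R (T y - z • (y : H)) = y

/-- The resolvent set `ρ(T)` of an unbounded operator `T`. -/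
def resolventSetOf (T : H →ₗ.[ℂ] H) : Set ℂ :=
  {z | ∃ R : H →L[ℂ] H, IsResolventAt T z R}

open Classical in
/-- The resolvent `(T - z)⁻¹` for `z ∈ ρ(T)` (and `0` otherwise). -/
noncomputable def resolventOf (T : H →ₗ.[ℂ] H) (z : ℂ) : H →L[ℂ] H :=
  if h : z ∈ resolventSetOf T then Classical.choose h else 0

theorem resolventOf_spec {T : H →ₗ.[ℂ] H} {z : ℂ} (h : z ∈ resolventSetOf T) :
    IsResolventAt T z (resolventOf T z) := by
  unfold resolventOf
  rw [dif_pos h]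
  exact Classical.choose_spec h

/-- The trace class `𝔖₁(H)`: `∑ ⟨|T| e_i, e_i⟩ < ∞` for every orthonormal basis `(e_i)`, where
`|T| = (T* T)^{1/2}`. -/
def IsTraceClass [CompleteSpace H] (T : H →L[ℂ] H) : Prop :=
  ∀ (ι : Type u) (e : HilbertBasis ι ℂ H),
    Summable fun i => (⟪e i, CFC.abs T (e i)⟫_ℂ).re

/-- `tr T = t`: in every orthonormal basis `(e_i)` the series `∑ ⟨T e_i, e_i⟩` of diagonal matrix
elements converges to `t`. (Mathlib's inner product is conjugate linear in the first slot.) -/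
def HasTrace (T : H →L[ℂ] H) (t : ℂ) : Prop :=
  ∀ (ι : Type u) (e : HilbertBasis ι ℂ H), HasSum (fun i => ⟪e i, T (e i)⟫_ℂ) t

end Abstract

/-- Lebesgue measure on `[0,1]`. -/
noncomputable abbrev unitMeasure : Measure ℝ := volume.restrict (Icc (0 : ℝ) 1)

/-- `ℂⁿ` with its Euclidean structure. -/
abbrev Cn (n : ℕ) : Type := EuclideanSpace ℂ (Fin n)

/-- The Hilbert space `L²([0,1]; ℂⁿ)`. -/
abbrev L2 (n : ℕ) : Type := Lp (Cn n) 2 unitMeasure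

/-- `Q ∈ L¹([0,1]; ℂ^{n×n})`. -/
def IsL1Potential {n : ℕ} (Q : ℝ → Matrix (Fin n) (Fin n) ℂ) : Prop :=
  ∀ j k, IntegrableOn (fun x => Q x j k) (Icc (0 : ℝ) 1)

/-- `y ∈ W^{1,1}([0,1]; ℂⁿ)`: `y` is absolutely continuous on `[0,1]` and `y' ∈ L¹`. -/
def IsW11 {n : ℕ} (y : ℝ → Cn n) : Prop :=
  AbsolutelyContinuousOnInterval y 0 1 ∧ IntegrableOn (deriv y) (Icc (0 : ℝ) 1)

/-- The differential expression `L(Q)y = -i B⁻¹ y' + Q(x) y`, with `B = diag(b₁, …, bₙ)`. -/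
noncomputable def diffExpr {n : ℕ} (b : Fin n → ℂ) (Q : ℝ → Matrix (Fin n) (Fin n) ℂ)
    (y : ℝ → Cn n) (x : ℝ) : Cn n :=
  WithLp.toLp 2 (-Complex.I • ((Matrix.diagonal b)⁻¹ *ᵥ (deriv y x).ofLp) + Q x *ᵥ (y x).ofLp)

theorem IsW11.ae_differentiableAt {n : ℕ} {y : ℝ → Cn n} (hy : IsW11 y) :
    ∀ᵐ x ∂unitMeasure, DifferentiableAt ℝ y x := by
  rw [ae_restrict_iff' measurableSet_Icc]
  have := hy.1.boundedVariationOn.ae_differentiableAt_of_mem_uIcc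
  simpa [uIcc_of_le (zero_le_one' ℝ)] using this

theorem diffExpr_add {n : ℕ} (b : Fin n → ℂ) (Q : ℝ → Matrix (Fin n) (Fin n) ℂ)
    {u v : ℝ → Cn n} (hu : IsW11 u) (hv : IsW11 v) :
    diffExpr b Q (u + v) =ᵐ[unitMeasure] diffExpr b Q u + diffExpr b Q v := by
  filter_upwards [hu.ae_differentiableAt, hv.ae_differentiableAt] with x h1 h2
  simp only [diffExpr, Pi.add_apply, deriv_add h1 h2, WithLp.ofLp_add, Matrix.mulVec_add,
    smul_add, ← WithLp.toLp_add]
  congr 1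
  abel

theorem diffExpr_smul {n : ℕ} (b : Fin n → ℂ) (Q : ℝ → Matrix (Fin n) (Fin n) ℂ)
    {u : ℝ → Cn n} (c : ℂ) (hu : IsW11 u) :
    diffExpr b Q (c • u) =ᵐ[unitMeasure] c • diffExpr b Q u := by
  filter_upwards [hu.ae_differentiableAt] with x h1
  simp only [diffExpr, Pi.smul_apply, deriv_const_smul c h1, WithLp.ofLp_smul, Matrix.mulVec_smul,
    ← WithLp.toLp_smul, smul_add]
  rw [smul_comm c (-Complex.I)]

theorem IsW11.add {n : ℕ} {u v : ℝ → Cn n} (hu : IsW11 u) (hv : IsW11 v) : IsW11 (u + v) := by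
  refine ⟨hu.1.add hv.1, (hu.2.add hv.2).congr ?_⟩
  filter_upwards [hu.ae_differentiableAt, hv.ae_differentiableAt] with x h1 h2
  exact (deriv_add h1 h2).symm

theorem IsW11.smul {n : ℕ} {u : ℝ → Cn n} (c : ℂ) (hu : IsW11 u) : IsW11 (c • u) := by
  refine ⟨hu.1.const_smul c, (Integrable.smul c hu.2).congr ?_⟩
  filter_upwards [hu.ae_differentiableAt] with x h1
  exact (deriv_const_smul c h1).symm

theorem isW11_zero {n : ℕ} : IsW11 (0 : ℝ → Cn n) := by
  refine ⟨ContDiffOn.absolutelyContinuousOnInterval contDiffOn_const, ?_⟩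
  simp only [deriv_zero]
  exact integrable_zero _ _ _

/-- The graph of the operator `L_{C,D}(Q)` in `L²([0,1]; ℂⁿ)`: all pairs `(y, L(Q)y)` such that
(the continuous representative `u` of) `y` lies in `W^{1,1}`, `L(Q)y ∈ L²` and
`C y(0) + D y(1) = 0`. -/
def bvpGraph {n : ℕ} (b : Fin n → ℂ) (Q : ℝ → Matrix (Fin n) (Fin n) ℂ)
    (C D : Matrix (Fin n) (Fin n) ℂ) : Submodule ℂ (L2 n × L2 n) where
  carrier := {p | ∃ u : ℝ → Cn n, p.1 =ᵐ[unitMeasure] u ∧ IsW11 u ∧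
    p.2 =ᵐ[unitMeasure] diffExpr b Q u ∧ C *ᵥ (u 0).ofLp + D *ᵥ (u 1).ofLp = 0}
  zero_mem' := by
    refine ⟨0, Lp.coeFn_zero _ _ _, isW11_zero, ?_, by simp⟩
    refine (Lp.coeFn_zero _ _ _).trans (Filter.Eventually.of_forall fun x => ?_)
    simp [diffExpr]
  add_mem' := by
    rintro p q ⟨u, hu1, hu2, hu3, hu4⟩ ⟨v, hv1, hv2, hv3, hv4⟩
    refine ⟨u + v, (Lp.coeFn_add _ _).trans (hu1.add hv1), hu2.add hv2,
      ((Lp.coeFn_add _ _).trans (hu3.add hv3)).trans (diffExpr_add b Q hu2 hv2).symm, ?_⟩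
    simp only [Pi.add_apply, WithLp.ofLp_add, Matrix.mulVec_add]
    rw [add_add_add_comm, hu4, hv4, add_zero]
  smul_mem' := by
    rintro c p ⟨u, hu1, hu2, hu3, hu4⟩
    refine ⟨c • u, (Lp.coeFn_smul _ _).trans (hu1.const_smul c), hu2.smul c,
      ((Lp.coeFn_smul _ _).trans (hu3.const_smul c)).trans (diffExpr_smul b Q c hu2).symm, ?_⟩
    simp only [Pi.smul_apply, WithLp.ofLp_smul, Matrix.mulVec_smul]
    rw [← smul_add, hu4, smul_zero]

/-- The operator `L_{C,D}(Q)` in `L²([0,1]; ℂⁿ)`. -/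
noncomputable def bvpOperator {n : ℕ} (b : Fin n → ℂ) (Q : ℝ → Matrix (Fin n) (Fin n) ℂ)
    (C D : Matrix (Fin n) (Fin n) ℂ) : L2 n →ₗ.[ℂ] L2 n :=
  (bvpGraph b Q C D).toLinearPMap

theorem bvpGraph_single_valued {n : ℕ} (b : Fin n → ℂ) (Q : ℝ → Matrix (Fin n) (Fin n) ℂ)
    (C D : Matrix (Fin n) (Fin n) ℂ) (p : L2 n × L2 n) (hp : p ∈ bvpGraph b Q C D)
    (h0 : p.1 = 0) : p.2 = 0 := by
  obtain ⟨u, hu1, hu2, hu3, -⟩ := hp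
  rw [h0] at hu1
  have h1 : u =ᵐ[unitMeasure] (fun _ => 0) := hu1.symm.trans (Lp.coeFn_zero _ _ _)
  have hc : ContinuousOn u (Icc (0 : ℝ) 1) := by
    simpa [uIcc_of_le (zero_le_one' ℝ)] using hu2.1.continuousOn
  have h2 : EqOn u (fun _ => 0) (Icc (0 : ℝ) 1) :=
    Measure.eqOn_Icc_of_ae_eq volume zero_ne_one h1 hc continuousOn_const
  apply Lp.ext
  refine (hu3.trans ?_).trans (Lp.coeFn_zero _ _ _).symm
  have h3 : ∀ᵐ x ∂unitMeasure, x ∈ Ioo (0 : ℝ) 1 := by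
    rw [unitMeasure, ← restrict_Ioo_eq_restrict_Icc]
    exact ae_restrict_mem measurableSet_Ioo
  filter_upwards [h3] with x hx
  have h4 : u =ᶠ[nhds x] fun _ => 0 := by
    filter_upwards [isOpen_Ioo.mem_nhds hx] with t ht using h2 (Ioo_subset_Icc_self ht)
  simp [diffExpr, h4.deriv_eq, h4.eq_of_nhds]

theorem bvpOperator_graph {n : ℕ} (b : Fin n → ℂ) (Q : ℝ → Matrix (Fin n) (Fin n) ℂ)
    (C D : Matrix (Fin n) (Fin n) ℂ) : (bvpOperator b Q C D).graph = bvpGraph b Q C D :=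
  Submodule.toLinearPMap_graph_eq _ (bvpGraph_single_valued b Q C D)

/-- `Φ(·) = Φ(·, z)` is the fundamental matrix of `L(Q)y = z y` on `[0,1]` with `Φ(0) = Iₙ`: each
column of `Φ` lies in `W^{1,1}` and solves the equation almost everywhere. -/
def IsFundamentalMatrix {n : ℕ} (b : Fin n → ℂ) (Q : ℝ → Matrix (Fin n) (Fin n) ℂ) (z : ℂ)
    (Φ : ℝ → Matrix (Fin n) (Fin n) ℂ) : Prop :=
  Φ 0 = 1 ∧ ∀ k : Fin n,
    IsW11 (fun x => (WithLp.toLp 2 ((Φ x).col k) : Cn n)) ∧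
    ∀ᵐ x ∂unitMeasure, diffExpr b Q (fun t => WithLp.toLp 2 ((Φ t).col k)) x =
      z • (WithLp.toLp 2 ((Φ x).col k) : Cn n)

/-- The entrywise integral over `[0,1]` of a matrix function. -/
noncomputable def matrixIntegral {n : ℕ} (F : ℝ → Matrix (Fin n) (Fin n) ℂ) :
    Matrix (Fin n) (Fin n) ℂ :=
  Matrix.of fun j k => ∫ x in (0 : ℝ)..1, F x j k

/-- The matrix function
`x ↦ (Φ₁(x)(C₁+D₁Φ₁(1))⁻¹C₁Φ₁(x)⁻¹ - Φ₂(x)(C₂+D₂Φ₂(1))⁻¹C₂Φ₂(x)⁻¹) i B`. -/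
noncomputable def traceIntegrand {n : ℕ} (b : Fin n → ℂ)
    (C₁ D₁ C₂ D₂ : Matrix (Fin n) (Fin n) ℂ) (Φ₁ Φ₂ : ℝ → Matrix (Fin n) (Fin n) ℂ) (x : ℝ) :
    Matrix (Fin n) (Fin n) ℂ :=
  (Φ₁ x * (C₁ + D₁ * Φ₁ 1)⁻¹ * C₁ * (Φ₁ x)⁻¹ - Φ₂ x * (C₂ + D₂ * Φ₂ 1)⁻¹ * C₂ * (Φ₂ x)⁻¹) *
    (Complex.I • Matrix.diagonal b)

end DiracBVP

/-!
With `Φⱼ` the fundamental matrix, `Ψⱼ = Φⱼ⁻¹` and `Nⱼ = (Cⱼ + DⱼΦⱼ(1))⁻¹Cⱼ`, variation of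
parameters gives the resolvent as `Rⱼf(x) = Φⱼ(x) (Nⱼ ∫₀¹ Ψⱼ iB f - ∫ₓ¹ Ψⱼ iB f)`. The first
summand has finite rank and trace `∫₀¹ tr(Φⱼ Nⱼ Ψⱼ iB)`, so it remains to see that the difference
of the two Volterra parts is nuclear with trace zero. Its kernel vanishes for `t < x`, and for
`x < t` it is `-(Φ₁(x)Ψ₁(t) - Φ₂(x)Ψ₂(t)) iB = -∫ₓᵗ Φ₁(x) w(s) Ψ₂(t) iB ds`, where `w` is the
integrable derivative of `Ψ₁Φ₂`. So it is an integral over `s` of the finite-rank operators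
`f ↦ -1_{x ≤ s} Φ₁(x) w(s) ∫_{t > s} Ψ₂ iB f`, whose nuclear norms are at most a constant times
`‖w(s)‖`; each of them has trace zero because its two factors have disjoint supports.
-/

namespace DiracBVP

section NuclearForms

universe u

section Factorisation

variable {𝕜 E F G : Type*} [RCLike 𝕜] [NormedAddCommGroup E] [NormedSpace 𝕜 E]
  [NormedAddCommGroup F] [InnerProductSpace 𝕜 F] [CompleteSpace F]
  [NormedAddCommGroup G] [NormedSpace 𝕜 G] [CompleteSpace G]

theorem exists_eq_comp_of_norm_le {S : E →L[𝕜] G} {T : E →L[𝕜] F} {c : ℝ}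
    (h : ∀ x, ‖S x‖ ≤ c * ‖T x‖) : ∃ U : F →L[𝕜] G, S = U ∘L T := by
  let K : Submodule 𝕜 F := T.range.topologicalClosure
  have : CompleteSpace K := T.range.isClosed_topologicalClosure.completeSpace_coe
  let j : E →ₗ[𝕜] K :=
    T.toLinearMap.codRestrict K fun x => T.range.le_topologicalClosure ⟨x, rfl⟩
  have hj : DenseRange j := fun y => by
    have hrange : ((↑) : K → F) '' range j = range T := by
      rw [← range_comp]
      rfl
    rw [closure_subtype, hrange]
    exact y.2
  refine ⟨S.toLinearMap.extendOfNorm j ∘L K.orthogonalProjectionOnto, ?_⟩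
  ext x
  have hproj : K.orthogonalProjectionOnto (T x) = j x :=
    K.orthogonalProjectionOnto_mem_subspace_eq_self (j x)
  rw [ContinuousLinearMap.comp_apply, ContinuousLinearMap.comp_apply, hproj]
  exact (LinearMap.extendOfNorm_eq (f := S.toLinearMap) hj ⟨c, h⟩ x).symm

end Factorisation

variable {H : Type u} [NormedAddCommGroup H] [InnerProductSpace ℂ H]

theorem norm_abs_apply [CompleteSpace H] (T : H →L[ℂ] H) (x : H) : ‖CFC.abs T x‖ = ‖T x‖ := by
  have hself : (CFC.abs T).adjoint = CFC.abs T := (CFC.abs_nonneg T).isSelfAdjoint.star_eq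
  have hsq : CFC.abs T (CFC.abs T x) = T.adjoint (T x) :=
    congrArg (fun A : H →L[ℂ] H => A x) (CFC.abs_mul_abs T)
  rw [@norm_eq_sqrt_re_inner ℂ, @norm_eq_sqrt_re_inner ℂ,
    ← ContinuousLinearMap.adjoint_inner_right, hself, hsq,
    ContinuousLinearMap.adjoint_inner_right]

theorem exists_abs_eq_comp [CompleteSpace H] (T : H →L[ℂ] H) :
    ∃ U : H →L[ℂ] H, CFC.abs T = U ∘L T :=
  exists_eq_comp_of_norm_le (c := 1) fun x => by rw [one_mul, norm_abs_apply]

/-- A form `β` on `H` is nuclear with trace `t` if its diagonal sums in every orthonormal basis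
converge to `t`, and still converge after composing the first argument with a bounded operator;
the latter is what passing from `T` to `|T|` requires. Sesquilinearity of `β` is not imposed. -/
def IsNuclearForm (β : H → H → ℂ) (t : ℂ) : Prop :=
  ∀ (ι : Type u) (e : HilbertBasis ι ℂ H),
    (∀ U : H →L[ℂ] H, Summable fun i => β (U (e i)) (e i)) ∧ HasSum (fun i => β (e i) (e i)) t

namespace IsNuclearForm

variable {β γ : H → H → ℂ} {s t : ℂ}

theorem isTraceClass [CompleteSpace H] (hβ : IsNuclearForm β t) {T : H →L[ℂ] H}
    (hT : ∀ g f, ⟪g, T f⟫_ℂ = β g f) : IsTraceClass T := by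
  obtain ⟨U, hU⟩ := exists_abs_eq_comp T
  intro ι e
  have hterm (i) : ⟪e i, CFC.abs T (e i)⟫_ℂ = β (U.adjoint (e i)) (e i) := by
    rw [hU, ContinuousLinearMap.comp_apply, ← hT, ContinuousLinearMap.adjoint_inner_left]
  simp only [hterm]
  exact Complex.reCLM.summable ((hβ ι e).1 U.adjoint)

theorem hasTrace (hβ : IsNuclearForm β t) {T : H →L[ℂ] H} (hT : ∀ g f, ⟪g, T f⟫_ℂ = β g f) :
    HasTrace T t := fun ι e => by
  simpa only [hT] using (hβ ι e).2

theorem sub (hβ : IsNuclearForm β s) (hγ : IsNuclearForm γ t) :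
    IsNuclearForm (fun g f => β g f - γ g f) (s - t) := fun ι e =>
  ⟨fun U => ((hβ ι e).1 U).sub ((hγ ι e).1 U), (hβ ι e).2.sub (hγ ι e).2⟩

theorem sum {κ : Type*} {s : Finset κ} {β : κ → H → H → ℂ} {t : κ → ℂ}
    (h : ∀ k ∈ s, IsNuclearForm (β k) (t k)) :
    IsNuclearForm (fun g f => ∑ k ∈ s, β k g f) (∑ k ∈ s, t k) := fun ι e =>
  ⟨fun U => summable_sum fun k hk => (h k hk ι e).1 U, hasSum_sum fun k hk => (h k hk ι e).2⟩

end IsNuclearForm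

section Integral

variable {𝕜 ι : Type*} [RCLike 𝕜] {X : Type*} [NormedAddCommGroup X] [InnerProductSpace 𝕜 X]

theorem countable_of_orthonormal [TopologicalSpace.SeparableSpace X] {v : ι → X}
    (hv : Orthonormal 𝕜 v) : Countable ι := by
  refine Pairwise.countable_of_isOpen_disjoint (s := fun i => Metric.ball (v i) (1 / 2))
    (fun i j hij => Metric.ball_disjoint_ball ?_) (fun _ => Metric.isOpen_ball)
    (fun i => ⟨v i, by simp⟩)
  have hsq : ‖v i - v j‖ ^ 2 = 2 := by
    rw [@norm_sub_sq 𝕜, hv.2 hij, hv.1 i, hv.1 j]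
    norm_num
  rw [dist_eq_norm]
  nlinarith [norm_nonneg (v i - v j)]

theorem sum_norm_inner_mul_norm_inner_le {v : ι → X} (hv : Orthonormal 𝕜 v) (s : Finset ι)
    (x y : X) : ∑ i ∈ s, ‖⟪v i, x⟫_𝕜‖ * ‖⟪y, v i⟫_𝕜‖ ≤ ‖x‖ * ‖y‖ := by
  refine (Real.sum_mul_le_sqrt_mul_sqrt s _ _).trans ?_
  gcongr
  · exact Real.sqrt_le_iff.2 ⟨norm_nonneg _, hv.sum_inner_products_le x⟩
  · refine Real.sqrt_le_iff.2 ⟨norm_nonneg _, ?_⟩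
    simpa only [norm_inner_symm y] using hv.sum_inner_products_le (s := s) y

variable {Ω : Type*} [MeasurableSpace Ω] {μ : Measure Ω} {ρ : Ω → ℝ}

theorem hasSum_integral_inner_mul_inner [TopologicalSpace.SeparableSpace X] {α κ : Ω → X}
    (hα : ∀ g, AEStronglyMeasurable (fun ω => ⟪g, α ω⟫_𝕜) μ)
    (hκ : ∀ f, AEStronglyMeasurable (fun ω => ⟪κ ω, f⟫_𝕜) μ)
    (hρ : Integrable ρ μ) (hle : ∀ᵐ ω ∂μ, ‖α ω‖ * ‖κ ω‖ ≤ ρ ω) (e : HilbertBasis ι 𝕜 X) :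
    HasSum (fun i => ∫ ω, ⟪e i, α ω⟫_𝕜 * ⟪κ ω, e i⟫_𝕜 ∂μ) (∫ ω, ⟪κ ω, α ω⟫_𝕜 ∂μ) := by
  have : Countable ι := countable_of_orthonormal e.orthonormal
  have hsum : ∀ᵐ ω ∂μ, ∀ s : Finset ι, ∑ i ∈ s, ‖⟪e i, α ω⟫_𝕜 * ⟪κ ω, e i⟫_𝕜‖ ≤ ρ ω := by
    filter_upwards [hle] with ω h s
    simpa only [norm_mul] using (sum_norm_inner_mul_norm_inner_le e.orthonormal s _ _).trans h
  have hint (i) : Integrable (fun ω => ⟪e i, α ω⟫_𝕜 * ⟪κ ω, e i⟫_𝕜) μ := by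
    refine hρ.mono' ((hα _).mul (hκ _)) ?_
    filter_upwards [hsum] with ω h
    simpa only [Finset.sum_singleton] using h {i}
  have hsummable : Summable fun i => ∫ ω, ‖⟪e i, α ω⟫_𝕜 * ⟪κ ω, e i⟫_𝕜‖ ∂μ := by
    refine summable_of_sum_le (c := ∫ ω, ρ ω ∂μ)
      (fun i => integral_nonneg fun ω => norm_nonneg _) fun s => ?_
    rw [← integral_finsetSum _ fun i _ => (hint i).norm]
    refine integral_mono_ae (integrable_finsetSum _ fun i _ => (hint i).norm) hρ ?_
    filter_upwards [hsum] with ω h using h s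
  have hlim (ω) : ∑' i, ⟪e i, α ω⟫_𝕜 * ⟪κ ω, e i⟫_𝕜 = ⟪κ ω, α ω⟫_𝕜 := by
    simpa only [mul_comm] using e.tsum_inner_mul_inner (κ ω) (α ω)
  simpa only [hlim] using hasSum_integral_of_summable_integral_norm hint hsummable

theorem IsNuclearForm.integral [CompleteSpace H] [TopologicalSpace.SeparableSpace H]
    {α κ : Ω → H} (hα : ∀ g, AEStronglyMeasurable (fun ω => ⟪g, α ω⟫_ℂ) μ)
    (hκ : ∀ f, AEStronglyMeasurable (fun ω => ⟪κ ω, f⟫_ℂ) μ)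
    (hρ : Integrable ρ μ) (hle : ∀ᵐ ω ∂μ, ‖α ω‖ * ‖κ ω‖ ≤ ρ ω) :
    IsNuclearForm (fun g f => ∫ ω, ⟪g, α ω⟫_ℂ * ⟪κ ω, f⟫_ℂ ∂μ) (∫ ω, ⟪κ ω, α ω⟫_ℂ ∂μ) := by
  refine fun ι e => ⟨fun U => ?_, hasSum_integral_inner_mul_inner hα hκ hρ hle e⟩
  have hα' (g) : AEStronglyMeasurable (fun ω => ⟪g, U.adjoint (α ω)⟫_ℂ) μ := by
    simpa only [ContinuousLinearMap.adjoint_inner_right] using hα (U g)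
  have hle' : ∀ᵐ ω ∂μ, ‖U.adjoint (α ω)‖ * ‖κ ω‖ ≤ ‖U.adjoint‖ * ρ ω := by
    filter_upwards [hle] with ω h
    calc ‖U.adjoint (α ω)‖ * ‖κ ω‖ ≤ ‖U.adjoint‖ * ‖α ω‖ * ‖κ ω‖ := by
          gcongr
          exact U.adjoint.le_opNorm _
      _ = ‖U.adjoint‖ * (‖α ω‖ * ‖κ ω‖) := mul_assoc _ _ _
      _ ≤ ‖U.adjoint‖ * ρ ω := by gcongr
  simpa only [ContinuousLinearMap.adjoint_inner_right] using
    (hasSum_integral_inner_mul_inner hα' hκ (hρ.const_mul _) hle' e).summable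

theorem IsNuclearForm.rankOne [CompleteSpace H] (x y : H) :
    IsNuclearForm (fun g f => ⟪g, x⟫_ℂ * ⟪y, f⟫_ℂ) ⟪y, x⟫_ℂ := fun ι e =>
  ⟨fun U => by
    simpa only [ContinuousLinearMap.adjoint_inner_right, mul_comm] using
      (e.hasSum_inner_mul_inner y (U.adjoint x)).summable,
    by simpa only [mul_comm] using e.hasSum_inner_mul_inner y x⟩

end Integral

end NuclearForms

section AbsoluteContinuity

section Metric

variable {X Y Z : Type*} [PseudoMetricSpace X] [PseudoMetricSpace Y] [PseudoMetricSpace Z]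
  {f : ℝ → X} {g : ℝ → Y} {h : ℝ → Z} {a b : ℝ}

theorem absolutelyContinuousOnInterval_of_dist_le_add {c d : ℝ}
    (hf : AbsolutelyContinuousOnInterval f a b) (hg : AbsolutelyContinuousOnInterval g a b)
    (hle : ∀ x ∈ uIcc a b, ∀ y ∈ uIcc a b,
      dist (h x) (h y) ≤ c * dist (f x) (f y) + d * dist (g x) (g y)) :
    AbsolutelyContinuousOnInterval h a b := by
  unfold AbsolutelyContinuousOnInterval at hf hg ⊢
  refine squeeze_zero' (.of_forall fun _ => Finset.sum_nonneg fun _ _ => dist_nonneg) ?_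
    (by simpa only [mul_zero, add_zero] using (hf.const_mul c).add (hg.const_mul d))
  rw [Filter.eventually_inf_principal]
  filter_upwards with I hI
  rw [Finset.mul_sum, Finset.mul_sum, ← Finset.sum_add_distrib]
  exact Finset.sum_le_sum fun i hi => hle _ (hI.1 i hi).1 _ (hI.1 i hi).2

theorem absolutelyContinuousOnInterval_of_dist_le {c : ℝ}
    (hf : AbsolutelyContinuousOnInterval f a b)
    (hle : ∀ x ∈ uIcc a b, ∀ y ∈ uIcc a b, dist (g x) (g y) ≤ c * dist (f x) (f y)) :
    AbsolutelyContinuousOnInterval g a b :=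
  absolutelyContinuousOnInterval_of_dist_le_add (d := 0) hf hf fun x hx y hy => by
    simpa only [zero_mul, add_zero] using hle x hx y hy

end Metric

variable {E F G : Type*} [NormedAddCommGroup E] [NormedSpace ℝ E] [NormedAddCommGroup F]
  [NormedSpace ℝ F] [NormedAddCommGroup G] [NormedSpace ℝ G] {a b : ℝ}

theorem absolutelyContinuousOnInterval_integral {v : ℝ → E} (hv : IntervalIntegrable v volume a b)
    {c : ℝ} (hc : c ∈ uIcc a b) :
    AbsolutelyContinuousOnInterval (fun x => ∫ t in c..x, v t) a b := by
  refine absolutelyContinuousOnInterval_of_dist_le (c := 1)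
    (hv.norm.absolutelyContinuousOnInterval_intervalIntegral hc) fun x hx y hy => ?_
  have hcx : IntervalIntegrable v volume c x := hv.mono_set (uIcc_subset_uIcc hc hx)
  have hcy : IntervalIntegrable v volume c y := hv.mono_set (uIcc_subset_uIcc hc hy)
  rw [one_mul, dist_eq_norm, dist_eq_norm, intervalIntegral.integral_interval_sub_left hcx hcy,
    intervalIntegral.integral_interval_sub_left hcx.norm hcy.norm]
  exact intervalIntegral.norm_integral_le_abs_integral_norm

theorem intervalIntegrable_clm_comp (L : E →L[ℝ] F) {v : ℝ → E}
    (hv : IntervalIntegrable v volume a b) : IntervalIntegrable (fun x => L (v x)) volume a b :=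
  ⟨L.integrable_comp hv.1, L.integrable_comp hv.2⟩

/-- `u` is absolutely continuous on the interval between `a` and `b`, with almost everywhere
derivative `u'`, which is integrable there. -/
structure HasACDeriv (u u' : ℝ → E) (a b : ℝ) : Prop where
  ac : AbsolutelyContinuousOnInterval u a b
  intervalIntegrable : IntervalIntegrable u' volume a b
  ae_hasDerivAt : ∀ᵐ x, x ∈ uIcc a b → HasDerivAt u (u' x) x

namespace HasACDeriv

variable {u u' v v' : ℝ → E}

theorem continuousOn (h : HasACDeriv u u' a b) : ContinuousOn u (uIcc a b) :=
  h.ac.continuousOn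

theorem mono (h : HasACDeriv u u' a b) {c d : ℝ} (hc : c ∈ uIcc a b) (hd : d ∈ uIcc a b) :
    HasACDeriv u u' c d where
  ac := h.ac.mono (uIcc_subset_uIcc hc hd)
  intervalIntegrable := h.intervalIntegrable.mono_set (uIcc_subset_uIcc hc hd)
  ae_hasDerivAt := by
    filter_upwards [h.ae_hasDerivAt] with x hx hxcd using hx (uIcc_subset_uIcc hc hd hxcd)

theorem congr_deriv (h : HasACDeriv u u' a b) (huv : ∀ᵐ x, x ∈ uIcc a b → u' x = v' x) :
    HasACDeriv u v' a b where
  ac := h.ac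
  intervalIntegrable := h.intervalIntegrable.congr_ae <| by
    rw [Filter.EventuallyEq, ae_restrict_iff' measurableSet_uIoc]
    filter_upwards [huv] with x hx hxab using hx (uIoc_subset_uIcc hxab)
  ae_hasDerivAt := by
    filter_upwards [h.ae_hasDerivAt, huv] with x hd heq hx
    exact heq hx ▸ hd hx

theorem const (c : E) : HasACDeriv (fun _ => c) (fun _ => 0) a b where
  ac := ContDiffOn.absolutelyContinuousOnInterval contDiffOn_const
  intervalIntegrable := intervalIntegrable_const
  ae_hasDerivAt := .of_forall fun x _ => hasDerivAt_const x c

theorem add (hu : HasACDeriv u u' a b) (hv : HasACDeriv v v' a b) :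
    HasACDeriv (fun x => u x + v x) (fun x => u' x + v' x) a b where
  ac := hu.ac.add hv.ac
  intervalIntegrable := hu.intervalIntegrable.add hv.intervalIntegrable
  ae_hasDerivAt := by
    filter_upwards [hu.ae_hasDerivAt, hv.ae_hasDerivAt] with x hux hvx hx
    exact (hux hx).add (hvx hx)

theorem neg (hu : HasACDeriv u u' a b) : HasACDeriv (fun x => -u x) (fun x => -u' x) a b where
  ac := hu.ac.neg
  intervalIntegrable := hu.intervalIntegrable.neg
  ae_hasDerivAt := by
    filter_upwards [hu.ae_hasDerivAt] with x hux hx using (hux hx).neg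

theorem sum {ι : Type*} (s : Finset ι) {u u' : ι → ℝ → E}
    (h : ∀ i ∈ s, HasACDeriv (u i) (u' i) a b) :
    HasACDeriv (fun x => ∑ i ∈ s, u i x) (fun x => ∑ i ∈ s, u' i x) a b := by
  classical
  induction s using Finset.induction_on with
  | empty => simpa only [Finset.sum_empty] using const 0
  | insert i s hi ih =>
    simpa only [Finset.sum_insert hi] using (h i (Finset.mem_insert_self i s)).add
      (ih fun j hj => h j (Finset.mem_insert_of_mem hj))

theorem clm_comp (L : E →L[ℝ] F) (hu : HasACDeriv u u' a b) :
    HasACDeriv (fun x => L (u x)) (fun x => L (u' x)) a b where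
  ac := absolutelyContinuousOnInterval_of_dist_le hu.ac fun _ _ _ _ => L.dist_le_opNorm _ _
  intervalIntegrable := intervalIntegrable_clm_comp L hu.intervalIntegrable
  ae_hasDerivAt := by
    filter_upwards [hu.ae_hasDerivAt] with x hux hx using L.hasFDerivAt.comp_hasDerivAt x (hux hx)

theorem comp {φ φ' p q : ℝ → ℝ} (hφ : ∀ t, HasDerivAt φ (φ' t) t) (hφ' : Continuous φ')
    (hp : HasACDeriv p q a b) : HasACDeriv (fun x => φ (p x)) (fun x => φ' (p x) * q x) a b where
  ac := by
    obtain ⟨r, hr⟩ := hp.ac.exists_bound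
    obtain ⟨c, hc⟩ := (isCompact_Icc (a := -r) (b := r)).exists_bound_of_continuousOn
      hφ'.continuousOn
    refine absolutelyContinuousOnInterval_of_dist_le (c := c) hp.ac fun x hx y hy => ?_
    have hlip := (convex_Icc (-r) r).norm_image_sub_le_of_norm_hasDerivWithin_le
      (fun t _ => (hφ t).hasDerivWithinAt) hc (abs_le.1 (hr y hy)) (abs_le.1 (hr x hx))
    simpa only [dist_eq_norm] using hlip
  intervalIntegrable := hp.intervalIntegrable.continuousOn_mul
    (hφ'.comp_continuousOn hp.continuousOn)
  ae_hasDerivAt := by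
    filter_upwards [hp.ae_hasDerivAt] with x hpx hx using (hφ _).comp x (hpx hx)

end HasACDeriv

section Bilinear

variable (B : E →L[ℝ] F →L[ℝ] G) {u u' : ℝ → E} {v v' : ℝ → F}

theorem intervalIntegrable_bilin_left (hu : ContinuousOn u (uIcc a b))
    (hv : IntervalIntegrable v volume a b) :
    IntervalIntegrable (fun x => B (u x) (v x)) volume a b := by
  obtain ⟨c, hc⟩ := isCompact_uIcc.exists_bound_of_continuousOn hu
  rw [intervalIntegrable_iff] at hv ⊢
  refine B.integrable_of_bilin_of_bdd_left c ?_ ?_ hv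
  · exact (hu.aestronglyMeasurable_of_isCompact isCompact_uIcc measurableSet_uIcc).mono_set
      uIoc_subset_uIcc
  · filter_upwards [ae_restrict_mem measurableSet_uIoc] with x hx using hc x (uIoc_subset_uIcc hx)

theorem intervalIntegrable_bilin_right (hu : IntervalIntegrable u volume a b)
    (hv : ContinuousOn v (uIcc a b)) :
    IntervalIntegrable (fun x => B (u x) (v x)) volume a b :=
  intervalIntegrable_bilin_left B.flip hv hu

theorem HasACDeriv.bilin (hu : HasACDeriv u u' a b) (hv : HasACDeriv v v' a b) :
    HasACDeriv (fun x => B (u x) (v x)) (fun x => B (u x) (v' x) + B (u' x) (v x)) a b where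
  ac := by
    obtain ⟨c, hc⟩ := hu.ac.exists_bound
    obtain ⟨d, hd⟩ := hv.ac.exists_bound
    refine absolutelyContinuousOnInterval_of_dist_le_add (c := ‖B‖ * d) (d := ‖B‖ * c)
      hu.ac hv.ac fun x hx y hy => ?_
    have hsplit : B (u x) (v x) - B (u y) (v y) = B (u x - u y) (v x) + B (u y) (v x - v y) := by
      simp only [map_sub, sub_apply]
      abel
    simp only [dist_eq_norm]
    rw [hsplit]
    calc ‖B (u x - u y) (v x) + B (u y) (v x - v y)‖
        ≤ ‖B‖ * ‖u x - u y‖ * ‖v x‖ + ‖B‖ * ‖u y‖ * ‖v x - v y‖ :=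
          norm_add_le_of_le (B.le_opNorm₂ _ _) (B.le_opNorm₂ _ _)
      _ ≤ ‖B‖ * ‖u x - u y‖ * d + ‖B‖ * c * ‖v x - v y‖ := by
          gcongr
          exacts [hd x hx, hc y hy]
      _ = ‖B‖ * d * ‖u x - u y‖ + ‖B‖ * c * ‖v x - v y‖ := by ring
  intervalIntegrable := (intervalIntegrable_bilin_left B hu.continuousOn hv.intervalIntegrable).add
    (intervalIntegrable_bilin_right B hu.intervalIntegrable hv.continuousOn)
  ae_hasDerivAt := by
    filter_upwards [hu.ae_hasDerivAt, hv.ae_hasDerivAt] with x hux hvx hx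
    exact B.hasDerivAt_of_bilinear (fun _ => hux hx) (fun _ => hvx hx)

end Bilinear

namespace HasACDeriv

variable [CompleteSpace E] {u u' v : ℝ → E} {c d : ℝ}

theorem integral (hv : IntervalIntegrable v volume a b) (hc : c ∈ uIcc a b) :
    HasACDeriv (fun x => ∫ t in c..x, v t) v a b where
  ac := absolutelyContinuousOnInterval_integral hv hc
  intervalIntegrable := hv
  ae_hasDerivAt := by
    filter_upwards [hv.ae_hasDerivAt_integral] with x hd hx using hd hx c hc

theorem integral_tail (hv : IntervalIntegrable v volume a b) (hc : c ∈ uIcc a b) :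
    HasACDeriv (fun x => ∫ t in x..c, v t) (fun x => -v x) a b := by
  simpa only [intervalIntegral.integral_symm c, neg_neg] using (integral hv hc).neg

theorem sub_eq_integral (h : HasACDeriv u u' a b) (hc : c ∈ uIcc a b) (hd : d ∈ uIcc a b) :
    u d - u c = ∫ t in c..d, u' t := by
  have hcd := h.mono hc hd
  have hdiff := hcd.add (integral hcd.intervalIntegrable left_mem_uIcc).neg
  obtain ⟨k, hk⟩ := hdiff.ac.const_of_ae_hasDerivAt_zero <| by
    simpa only [add_neg_cancel] using hdiff.ae_hasDerivAt
  have heq := (hk d right_mem_uIcc).trans (hk c left_mem_uIcc).symm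
  simp only [intervalIntegral.integral_same, neg_zero, add_zero] at heq
  rw [← heq, sub_add_cancel_left, neg_neg]

theorem eq_of_deriv_zero (h : HasACDeriv u (fun _ => 0) a b) (hc : c ∈ uIcc a b)
    (hd : d ∈ uIcc a b) : u c = u d := by
  rw [eq_comm, ← sub_eq_zero, h.sub_eq_integral hc hd, intervalIntegral.integral_zero]

end HasACDeriv

theorem integral_bilin_integral_tail [CompleteSpace E] [CompleteSpace F] [CompleteSpace G]
    (B : E →L[ℝ] F →L[ℝ] G) {p : ℝ → E} {v : ℝ → F} (hp : IntervalIntegrable p volume a b)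
    (hv : IntervalIntegrable v volume a b) :
    ∫ x in a..b, B (p x) (∫ s in x..b, v s) = ∫ s in a..b, B (∫ x in a..s, p x) (v s) := by
  have hP := HasACDeriv.integral hp left_mem_uIcc
  have hV := HasACDeriv.integral_tail hv right_mem_uIcc
  have hzero := (HasACDeriv.bilin B hP hV).sub_eq_integral left_mem_uIcc right_mem_uIcc
  rw [intervalIntegral.integral_add
    (intervalIntegrable_bilin_left B hP.continuousOn hV.intervalIntegrable)
    (intervalIntegrable_bilin_right B hp hV.continuousOn)] at hzero
  simp only [intervalIntegral.integral_same, map_zero, zero_apply, sub_zero, map_neg,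
    intervalIntegral.integral_neg] at hzero
  rw [eq_comm, neg_add_eq_zero] at hzero
  exact hzero.symm

end AbsoluteContinuity

section LinearODE

variable {E : Type*} [NormedAddCommGroup E] [NormedSpace ℝ E] {A : ℝ → E →L[ℝ] E} {a b : ℝ}

/-- The weight `exp (2 ∫ ‖A‖)`, in which the Picard map of `u' = A u` contracts by `1 / 2`. -/
noncomputable def picardWeight (A : ℝ → E →L[ℝ] E) (a x : ℝ) : ℝ :=
  Real.exp (∫ t in a..x, 2 * ‖A t‖)

theorem picardWeight_self : picardWeight A a a = 1 := by
  rw [picardWeight, intervalIntegral.integral_same, Real.exp_zero]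

theorem picardWeight_pos (x : ℝ) : 0 < picardWeight A a x := Real.exp_pos _

theorem hasACDeriv_picardWeight (hA : IntervalIntegrable A volume a b) :
    HasACDeriv (picardWeight A a) (fun x => picardWeight A a x * (2 * ‖A x‖)) a b :=
  (HasACDeriv.integral (hA.norm.const_mul 2) left_mem_uIcc).comp (φ := Real.exp)
    Real.hasDerivAt_exp Real.continuous_exp

/-- The integrand `A u` of the Picard map, for `u = ψ` times the weight. -/
noncomputable def picardIntegrand (A : ℝ → E →L[ℝ] E) (hab : a ≤ b) (ψ : C(Icc a b, E)) (x : ℝ) :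
    E :=
  picardWeight A a x • A x (IccExtend hab ψ x)

theorem intervalIntegrable_picardIntegrand (hA : IntervalIntegrable A volume a b) (hab : a ≤ b)
    (ψ : C(Icc a b, E)) : IntervalIntegrable (picardIntegrand A hab ψ) volume a b :=
  (intervalIntegrable_bilin_right (.id ℝ (E →L[ℝ] E)) hA
    ψ.continuous.Icc_extend'.continuousOn).continuousOn_smul
      (hasACDeriv_picardWeight hA).continuousOn

theorem norm_picardIntegrand_sub_le (hab : a ≤ b) (ψ χ : C(Icc a b, E)) (x : ℝ) :
    ‖picardIntegrand A hab ψ x - picardIntegrand A hab χ x‖ ≤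
      picardWeight A a x * (2 * ‖A x‖) * (dist ψ χ / 2) := by
  have hdist : ‖IccExtend hab ψ x - IccExtend hab χ x‖ ≤ dist ψ χ := by
    rw [← dist_eq_norm]
    exact ContinuousMap.dist_apply_le_dist _
  rw [picardIntegrand, picardIntegrand, ← smul_sub, ← map_sub, norm_smul,
    Real.norm_of_nonneg (picardWeight_pos x).le]
  calc picardWeight A a x * ‖A x (IccExtend hab ψ x - IccExtend hab χ x)‖
      ≤ picardWeight A a x * (‖A x‖ * dist ψ χ) := by
        gcongr
        · exact (picardWeight_pos x).le
        · exact (A x).le_opNorm_of_le hdist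
    _ = picardWeight A a x * (2 * ‖A x‖) * (dist ψ χ / 2) := by ring

theorem norm_integral_picardIntegrand_sub_le (hA : IntervalIntegrable A volume a b) (hab : a ≤ b)
    (ψ χ : C(Icc a b, E)) {x : ℝ} (hx : x ∈ Icc a b) :
    ‖(∫ t in a..x, picardIntegrand A hab ψ t) - ∫ t in a..x, picardIntegrand A hab χ t‖ ≤
      picardWeight A a x * (dist ψ χ / 2) := by
  have hx' : x ∈ uIcc a b := Icc_subset_uIcc hx
  have hint (ψ) : IntervalIntegrable (picardIntegrand A hab ψ) volume a x :=
    (intervalIntegrable_picardIntegrand hA hab ψ).mono_set (uIcc_subset_uIcc left_mem_uIcc hx')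
  have hW := (hasACDeriv_picardWeight hA).mono left_mem_uIcc hx'
  rw [← intervalIntegral.integral_sub (hint ψ) (hint χ)]
  calc ‖∫ t in a..x, (picardIntegrand A hab ψ t - picardIntegrand A hab χ t)‖
      ≤ ∫ t in a..x, picardWeight A a t * (2 * ‖A t‖) * (dist ψ χ / 2) :=
        intervalIntegral.norm_integral_le_of_norm_le hx.1
          (.of_forall fun t _ => norm_picardIntegrand_sub_le hab ψ χ t)
          (hW.intervalIntegrable.mul_const _)
    _ = (picardWeight A a x - 1) * (dist ψ χ / 2) := by
        rw [intervalIntegral.integral_mul_const, ← hW.sub_eq_integral left_mem_uIcc right_mem_uIcc,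
          picardWeight_self]
    _ ≤ picardWeight A a x * (dist ψ χ / 2) := by
        gcongr
        exact sub_le_self _ zero_le_one

variable [CompleteSpace E]

theorem continuousOn_inv_picardWeight_smul (hA : IntervalIntegrable A volume a b) (hab : a ≤ b)
    (c : E) (ψ : C(Icc a b, E)) :
    ContinuousOn (fun x => (picardWeight A a x)⁻¹ • (c + ∫ t in a..x, picardIntegrand A hab ψ t))
      (Icc a b) := by
  rw [← uIcc_of_le hab]
  exact ((hasACDeriv_picardWeight hA).continuousOn.inv₀ fun x _ => (picardWeight_pos x).ne').smul
    (continuousOn_const.add (HasACDeriv.integral (intervalIntegrable_picardIntegrand hA hab ψ)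
      left_mem_uIcc).continuousOn)

/-- The Picard map of `u' = A u`, `u a = c`, conjugated by the weight. -/
noncomputable def picardMap (hA : IntervalIntegrable A volume a b) (hab : a ≤ b) (c : E)
    (ψ : C(Icc a b, E)) : C(Icc a b, E) :=
  ⟨_, (continuousOn_inv_picardWeight_smul hA hab c ψ).domRestrict⟩

theorem picardMap_apply (hA : IntervalIntegrable A volume a b) (hab : a ≤ b) (c : E)
    (ψ : C(Icc a b, E)) (x : Icc a b) : picardMap hA hab c ψ x =
      (picardWeight A a x)⁻¹ • (c + ∫ t in a..x, picardIntegrand A hab ψ t) := rfl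

theorem contractingWith_picardMap (hA : IntervalIntegrable A volume a b) (hab : a ≤ b) (c : E) :
    ContractingWith (1 / 2) (picardMap hA hab c) := by
  refine ⟨by norm_num, LipschitzWith.of_dist_le_mul fun ψ χ => ?_⟩
  refine (ContinuousMap.dist_le (by positivity)).2 fun x => ?_
  rw [dist_eq_norm, picardMap_apply, picardMap_apply, ← smul_sub, add_sub_add_left_eq_sub,
    norm_smul, norm_inv, Real.norm_of_nonneg (picardWeight_pos (x : ℝ)).le,
    inv_mul_le_iff₀ (picardWeight_pos (x : ℝ))]
  refine (norm_integral_picardIntegrand_sub_le hA hab ψ χ x.2).trans_eq ?_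
  push_cast
  ring

theorem exists_hasACDeriv_clm_apply (hA : IntervalIntegrable A volume a b) (hab : a ≤ b) (c : E) :
    ∃ u : ℝ → E, HasACDeriv u (fun x => A x (u x)) a b ∧ u a = c := by
  have hcontr := contractingWith_picardMap hA hab c
  let ψ : C(Icc a b, E) := hcontr.fixedPoint
  have hsol : ∀ x ∈ uIcc a b, picardWeight A a x • IccExtend hab ψ x =
      c + ∫ t in a..x, picardIntegrand A hab ψ t := fun x hx => by
    rw [uIcc_of_le hab] at hx
    have hfix : picardMap hA hab c ψ ⟨x, hx⟩ = ψ ⟨x, hx⟩ :=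
      congrArg (fun χ : C(Icc a b, E) => χ ⟨x, hx⟩) hcontr.fixedPoint_isFixedPt
    rw [IccExtend_of_mem hab _ hx, ← hfix, picardMap_apply]
    exact smul_inv_smul₀ (picardWeight_pos x).ne' _
  refine ⟨fun x => c + ∫ t in a..x, picardIntegrand A hab ψ t, ?_, by simp⟩
  refine HasACDeriv.congr_deriv (u' := picardIntegrand A hab ψ) ?_
    (.of_forall fun x hx => ?_)
  · simpa only [zero_add] using (HasACDeriv.const c).add
      (HasACDeriv.integral (intervalIntegrable_picardIntegrand hA hab ψ) left_mem_uIcc)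
  · beta_reduce
    rw [← hsol x hx, map_smul, picardIntegrand]

theorem exists_hasACDeriv_bilin {F : Type*} [NormedAddCommGroup F] [NormedSpace ℝ F]
    (B : F →L[ℝ] E →L[ℝ] E) {A : ℝ → F} (hA : IntervalIntegrable A volume a b) (hab : a ≤ b)
    (c : E) : ∃ u : ℝ → E, HasACDeriv u (fun x => B (A x) (u x)) a b ∧ u a = c :=
  exists_hasACDeriv_clm_apply (intervalIntegrable_clm_comp B hA) hab c

end LinearODE

section FundamentalPair

variable {E : Type*} [NormedAddCommGroup E] [NormedSpace ℂ E] {a b : ℝ}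

theorem HasACDeriv.mul {Y Y' Z Z' : ℝ → E →L[ℂ] E} (hY : HasACDeriv Y Y' a b)
    (hZ : HasACDeriv Z Z' a b) :
    HasACDeriv (fun x => Y x * Z x) (fun x => Y x * Z' x + Y' x * Z x) a b :=
  HasACDeriv.bilin ((ContinuousLinearMap.mul ℂ (E →L[ℂ] E)).bilinearRestrictScalars ℝ) hY hZ

theorem HasACDeriv.apply {Y Y' : ℝ → E →L[ℂ] E} {u u' : ℝ → E} (hY : HasACDeriv Y Y' a b)
    (hu : HasACDeriv u u' a b) :
    HasACDeriv (fun x => Y x (u x)) (fun x => Y x (u' x) + Y' x (u x)) a b :=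
  HasACDeriv.bilin ((ContinuousLinearMap.id ℂ (E →L[ℂ] E)).bilinearRestrictScalars ℝ) hY hu

theorem intervalIntegrable_apply_left {Y : ℝ → E →L[ℂ] E} {h : ℝ → E}
    (hY : ContinuousOn Y (uIcc a b)) (hh : IntervalIntegrable h volume a b) :
    IntervalIntegrable (fun x => Y x (h x)) volume a b :=
  intervalIntegrable_bilin_left ((ContinuousLinearMap.id ℂ (E →L[ℂ] E)).bilinearRestrictScalars ℝ)
    hY hh

theorem intervalIntegrable_apply_right {Y : ℝ → E →L[ℂ] E} {h : ℝ → E}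
    (hY : IntervalIntegrable Y volume a b) (hh : ContinuousOn h (uIcc a b)) :
    IntervalIntegrable (fun x => Y x (h x)) volume a b :=
  intervalIntegrable_bilin_right ((ContinuousLinearMap.id ℂ (E →L[ℂ] E)).bilinearRestrictScalars ℝ)
    hY hh

/-- `Φ` is the fundamental solution of `y' = A y` normalized at `a`, and `Ψ` is its inverse,
characterised by the adjoint equation. -/
structure IsFundamentalPair (A Φ Ψ : ℝ → E →L[ℂ] E) (a b : ℝ) : Prop where
  left_eq_one : Φ a = 1
  right_eq_one : Ψ a = 1
  hasACDeriv_left : HasACDeriv Φ (fun x => A x * Φ x) a b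
  hasACDeriv_right : HasACDeriv Ψ (fun x => -(Ψ x * A x)) a b

/-- The solution of `y' = A y + h` given by variation of constants from the fundamental solution `Φ`
and its inverse `Ψ`. The operator `N` encodes the boundary condition: `N = (C + D Φ(b))⁻¹ C` for
`C y(a) + D y(b) = 0`. -/
noncomputable def greenSolution (Φ Ψ : ℝ → E →L[ℂ] E) (N : E →L[ℂ] E) (a b : ℝ) (h : ℝ → E)
    (x : ℝ) : E :=
  Φ x (N (∫ t in a..b, Ψ t (h t)) - ∫ t in x..b, Ψ t (h t))

theorem exists_hasACDeriv_mul_left [CompleteSpace E] {A : ℝ → E →L[ℂ] E}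
    (hA : IntervalIntegrable A volume a b) (hab : a ≤ b) :
    ∃ Φ : ℝ → E →L[ℂ] E, HasACDeriv Φ (fun x => A x * Φ x) a b ∧ Φ a = 1 :=
  exists_hasACDeriv_bilin ((ContinuousLinearMap.mul ℂ (E →L[ℂ] E)).bilinearRestrictScalars ℝ) hA hab
    1

theorem exists_hasACDeriv_neg_mul_right [CompleteSpace E] {A : ℝ → E →L[ℂ] E}
    (hA : IntervalIntegrable A volume a b) (hab : a ≤ b) :
    ∃ Ψ : ℝ → E →L[ℂ] E, HasACDeriv Ψ (fun x => -(Ψ x * A x)) a b ∧ Ψ a = 1 :=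
  exists_hasACDeriv_bilin
    ((-(ContinuousLinearMap.mul ℂ (E →L[ℂ] E)).flip).bilinearRestrictScalars ℝ) hA hab 1

namespace IsFundamentalPair

variable {A Φ Ψ : ℝ → E →L[ℂ] E}

theorem continuousOn_left (P : IsFundamentalPair A Φ Ψ a b) : ContinuousOn Φ (uIcc a b) :=
  P.hasACDeriv_left.continuousOn

theorem continuousOn_right (P : IsFundamentalPair A Φ Ψ a b) : ContinuousOn Ψ (uIcc a b) :=
  P.hasACDeriv_right.continuousOn

theorem right_mul_left [CompleteSpace E] (P : IsFundamentalPair A Φ Ψ a b) {x : ℝ}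
    (hx : x ∈ uIcc a b) : Ψ x * Φ x = 1 := by
  have hconst : HasACDeriv (fun x => Ψ x * Φ x) (fun _ => 0) a b := by
    simpa only [neg_mul, mul_assoc, add_neg_cancel] using P.hasACDeriv_right.mul P.hasACDeriv_left
  rw [hconst.eq_of_deriv_zero hx left_mem_uIcc, P.left_eq_one, P.right_eq_one, mul_one]

variable [FiniteDimensional ℂ E]

theorem left_mul_right (P : IsFundamentalPair A Φ Ψ a b) {x : ℝ} (hx : x ∈ uIcc a b) :
    Φ x * Ψ x = 1 := by
  have hlin : (Ψ x).toLinearMap * (Φ x).toLinearMap = 1 :=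
    congrArg ContinuousLinearMap.toLinearMap (P.right_mul_left hx)
  exact ContinuousLinearMap.coe_injective (mul_eq_one_comm.1 hlin)

theorem left_apply_right_apply (P : IsFundamentalPair A Φ Ψ a b) {x : ℝ} (hx : x ∈ uIcc a b)
    (v : E) : Φ x (Ψ x v) = v :=
  congrArg (fun T : E →L[ℂ] E => T v) (P.left_mul_right hx)

theorem hasACDeriv_integral_tail (P : IsFundamentalPair A Φ Ψ a b) {h : ℝ → E}
    (hh : IntervalIntegrable h volume a b) :
    HasACDeriv (fun x => ∫ t in x..b, Ψ t (h t)) (fun x => -Ψ x (h x)) a b :=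
  have := FiniteDimensional.complete ℂ E
  .integral_tail (intervalIntegrable_apply_left P.continuousOn_right hh) right_mem_uIcc

theorem right_apply_add_integral_tail_eq (P : IsFundamentalPair A Φ Ψ a b) {u h : ℝ → E}
    (hh : IntervalIntegrable h volume a b) (hu : HasACDeriv u (fun x => A x (u x) + h x) a b)
    {x : ℝ} (hx : x ∈ uIcc a b) : Ψ x (u x) + ∫ t in x..b, Ψ t (h t) = Ψ b (u b) := by
  have hconst : HasACDeriv (fun x => Ψ x (u x) + ∫ t in x..b, Ψ t (h t)) (fun _ => 0) a b := by
    convert (P.hasACDeriv_right.apply hu).add (P.hasACDeriv_integral_tail hh) using 2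
    simp
  simpa using hconst.eq_of_deriv_zero hx right_mem_uIcc

theorem eq_of_boundary (P : IsFundamentalPair A Φ Ψ a b) {C D M : E →L[ℂ] E}
    (hM : M * (C + D * Φ b) = 1) {u h : ℝ → E} (hh : IntervalIntegrable h volume a b)
    (hu : HasACDeriv u (fun x => A x (u x) + h x) a b) (hbc : C (u a) + D (u b) = 0)
    {x : ℝ} (hx : x ∈ uIcc a b) :
    u x = greenSolution Φ Ψ (M * C) a b h x := by
  set k := Ψ b (u b) with hk
  have hconst {y : ℝ} (hy : y ∈ uIcc a b) : Ψ y (u y) = k - ∫ t in y..b, Ψ t (h t) :=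
    eq_sub_of_add_eq (P.right_apply_add_integral_tail_eq hh hu hy)
  have hua : u a = k - ∫ t in a..b, Ψ t (h t) := by
    rw [← hconst left_mem_uIcc, P.right_eq_one, one_apply_eq_self]
  have hub : u b = Φ b k := (P.left_apply_right_apply right_mem_uIcc _).symm
  have hkC : (C + D * Φ b) k = C (∫ t in a..b, Ψ t (h t)) := by
    rw [hua, hub, map_sub, sub_add_eq_add_sub, sub_eq_zero] at hbc
    exact hbc
  have hkM : k = (M * C) (∫ t in a..b, Ψ t (h t)) := by
    rw [mul_apply_eq_comp, ← hkC, ← mul_apply_eq_comp, hM, one_apply_eq_self]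
  rw [greenSolution, ← hkM, ← hconst hx, P.left_apply_right_apply hx]

end IsFundamentalPair

section Transition

variable {A₁ A₂ Φ₁ Φ₂ Ψ₁ Ψ₂ : ℝ → E →L[ℂ] E}

/-- The derivative of `Ψ₁ Φ₂`, where `Φ₂` solves `Φ₂' = A₂ Φ₂` and `Ψ₁` solves
`Ψ₁' = -Ψ₁ A₁`. -/
noncomputable def transitionRate (A₁ A₂ Ψ₁ Φ₂ : ℝ → E →L[ℂ] E) (x : ℝ) : E →L[ℂ] E :=
  Ψ₁ x * (A₂ x - A₁ x) * Φ₂ x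

namespace IsFundamentalPair

theorem hasACDeriv_right_mul_left (P₁ : IsFundamentalPair A₁ Φ₁ Ψ₁ a b)
    (P₂ : IsFundamentalPair A₂ Φ₂ Ψ₂ a b) :
    HasACDeriv (fun x => Ψ₁ x * Φ₂ x) (transitionRate A₁ A₂ Ψ₁ Φ₂) a b := by
  convert P₁.hasACDeriv_right.mul P₂.hasACDeriv_left using 1
  ext1 x
  rw [transitionRate]
  noncomm_ring

variable [FiniteDimensional ℂ E]

theorem hasACDeriv_integral_tail_sub (P₁ : IsFundamentalPair A₁ Φ₁ Ψ₁ a b)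
    (P₂ : IsFundamentalPair A₂ Φ₂ Ψ₂ a b) {h : ℝ → E} (hh : IntervalIntegrable h volume a b) :
    HasACDeriv
      (fun x => (∫ t in x..b, Ψ₁ t (h t)) - (Ψ₁ x * Φ₂ x) (∫ t in x..b, Ψ₂ t (h t)))
      (fun x => -transitionRate A₁ A₂ Ψ₁ Φ₂ x (∫ t in x..b, Ψ₂ t (h t))) a b := by
  have hsum := (P₁.hasACDeriv_integral_tail hh).add
    ((P₁.hasACDeriv_right_mul_left P₂).apply (P₂.hasACDeriv_integral_tail hh)).neg
  simp only [← sub_eq_add_neg] at hsum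
  refine hsum.congr_deriv (.of_forall fun x hx => ?_)
  rw [map_neg, mul_apply_eq_comp, P₂.left_apply_right_apply hx]
  abel

theorem left_apply_integral_tail_sub (P₁ : IsFundamentalPair A₁ Φ₁ Ψ₁ a b)
    (P₂ : IsFundamentalPair A₂ Φ₂ Ψ₂ a b) {h : ℝ → E} (hh : IntervalIntegrable h volume a b)
    {x : ℝ} (hx : x ∈ uIcc a b) :
    Φ₁ x (∫ t in x..b, Ψ₁ t (h t)) - Φ₂ x (∫ t in x..b, Ψ₂ t (h t)) =
      Φ₁ x (∫ s in x..b, transitionRate A₁ A₂ Ψ₁ Φ₂ s (∫ t in s..b, Ψ₂ t (h t))) := by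
  have := FiniteDimensional.complete ℂ E
  have hdiff := (P₁.hasACDeriv_integral_tail_sub P₂ hh).sub_eq_integral hx right_mem_uIcc
  simp only [intervalIntegral.integral_same, map_zero, sub_zero, zero_sub,
    intervalIntegral.integral_neg, neg_inj] at hdiff
  rw [← hdiff, map_sub, mul_apply_eq_comp, P₁.left_apply_right_apply hx]

theorem greenSolution_sub_greenSolution (P₁ : IsFundamentalPair A₁ Φ₁ Ψ₁ a b)
    (P₂ : IsFundamentalPair A₂ Φ₂ Ψ₂ a b) (N₁ N₂ : E →L[ℂ] E) {h : ℝ → E}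
    (hh : IntervalIntegrable h volume a b) {x : ℝ} (hx : x ∈ uIcc a b) :
    greenSolution Φ₁ Ψ₁ N₁ a b h x - greenSolution Φ₂ Ψ₂ N₂ a b h x =
      Φ₁ x (N₁ (∫ t in a..b, Ψ₁ t (h t))) - Φ₂ x (N₂ (∫ t in a..b, Ψ₂ t (h t))) -
        Φ₁ x (∫ s in x..b, transitionRate A₁ A₂ Ψ₁ Φ₂ s (∫ t in s..b, Ψ₂ t (h t))) := by
  rw [← P₁.left_apply_integral_tail_sub P₂ hh hx, greenSolution, greenSolution, map_sub, map_sub,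
    sub_sub_sub_comm]

end IsFundamentalPair

end Transition

end FundamentalPair

section SquareIntegrable

variable {E : Type*} [NormedAddCommGroup E] {a b : ℝ}

section IndicatorLp

variable {Ω : Type*} [MeasurableSpace Ω] {μ : Measure Ω} {u v : Ω → E} {S T : Set Ω}

/-- The truncation of `u` to `S`, as an element of `L²`. -/
noncomputable def indicatorLp (hu : MemLp u 2 μ) (hS : MeasurableSet S) : Lp E 2 μ :=
  (hu.indicator hS).toLp (S.indicator u)

theorem coeFn_indicatorLp (hu : MemLp u 2 μ) (hS : MeasurableSet S) :
    indicatorLp hu hS =ᵐ[μ] S.indicator u :=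
  (hu.indicator hS).coeFn_toLp

theorem norm_indicatorLp_le (hu : MemLp u 2 μ) (hS : MeasurableSet S) :
    ‖indicatorLp hu hS‖ ≤ ‖hu.toLp u‖ := by
  rw [indicatorLp, Lp.norm_toLp, Lp.norm_toLp]
  exact ENNReal.toReal_mono hu.eLpNorm_ne_top (eLpNorm_indicator_le _)

variable [InnerProductSpace ℂ E]

theorem inner_indicatorLp_right (hu : MemLp u 2 μ) (hS : MeasurableSet S) (g : Lp E 2 μ) :
    ⟪g, indicatorLp hu hS⟫_ℂ = ∫ x in S, ⟪g x, u x⟫_ℂ ∂μ := by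
  rw [L2.inner_def, ← integral_indicator hS]
  refine integral_congr_ae ?_
  filter_upwards [coeFn_indicatorLp hu hS] with x hx
  by_cases h : x ∈ S <;> simp [hx, h]

theorem inner_indicatorLp_left (hu : MemLp u 2 μ) (hS : MeasurableSet S) (f : Lp E 2 μ) :
    ⟪indicatorLp hu hS, f⟫_ℂ = ∫ x in S, ⟪u x, f x⟫_ℂ ∂μ := by
  rw [← inner_conj_symm, inner_indicatorLp_right, ← integral_conj]
  simp only [inner_conj_symm]

theorem inner_indicatorLp_eq_zero_of_disjoint (hu : MemLp u 2 μ) (hv : MemLp v 2 μ)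
    (hS : MeasurableSet S) (hT : MeasurableSet T) (hST : Disjoint S T) :
    ⟪indicatorLp hu hS, indicatorLp hv hT⟫_ℂ = 0 := by
  rw [inner_indicatorLp_left]
  refine setIntegral_eq_zero_of_ae_eq_zero ?_
  filter_upwards [coeFn_indicatorLp hv hT] with x hx hxS
  rw [hx, indicator_of_notMem (disjoint_left.1 hST hxS), inner_zero_right]

end IndicatorLp

theorem memLp_of_continuousOn {p : ENNReal} {u : ℝ → E} (hu : ContinuousOn u (uIcc a b)) :
    MemLp u p (volume.restrict (Icc a b)) := by
  obtain ⟨c, hc⟩ := isCompact_uIcc.exists_bound_of_continuousOn hu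
  refine MemLp.of_bound ((hu.mono Icc_subset_uIcc).aestronglyMeasurable measurableSet_Icc) c ?_
  filter_upwards [ae_restrict_mem measurableSet_Icc] with x hx using hc x (Icc_subset_uIcc hx)

theorem intervalIntegrable_coeFn (hab : a ≤ b) (f : Lp E 2 (volume.restrict (Icc a b))) :
    IntervalIntegrable f volume a b :=
  (intervalIntegrable_iff_integrableOn_Icc_of_le hab).2 ((Lp.memLp f).integrable one_le_two)

theorem integral_restrict_Icc {F : Type*} [NormedAddCommGroup F] [NormedSpace ℝ F] (hab : a ≤ b)
    (G : ℝ → F) : ∫ x, G x ∂volume.restrict (Icc a b) = ∫ x in a..b, G x := by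
  rw [intervalIntegral.integral_of_le hab, integral_Icc_eq_integral_Ioc]

theorem setIntegral_Iic_restrict_Icc {F : Type*} [NormedAddCommGroup F] [NormedSpace ℝ F]
    (G : ℝ → F) {s : ℝ} (hs : s ∈ Icc a b) :
    ∫ x in Iic s, G x ∂volume.restrict (Icc a b) = ∫ x in a..s, G x := by
  have hset : Iic s ∩ Icc a b = Icc a s := by
    ext x
    exact ⟨fun h => ⟨h.2.1, h.1⟩, fun h => ⟨h.2, h.1, h.2.trans hs.2⟩⟩
  rw [Measure.restrict_restrict measurableSet_Iic, hset, integral_restrict_Icc hs.1]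

theorem setIntegral_Ioi_restrict_Icc {F : Type*} [NormedAddCommGroup F] [NormedSpace ℝ F]
    (G : ℝ → F) {s : ℝ} (hs : s ∈ Icc a b) :
    ∫ x in Ioi s, G x ∂volume.restrict (Icc a b) = ∫ x in s..b, G x := by
  have hset : Ioi s ∩ Icc a b = Ioc s b := by
    ext x
    exact ⟨fun h => ⟨h.1, h.2.2⟩, fun h => ⟨h.1, hs.1.trans h.1.le, h.2⟩⟩
  rw [Measure.restrict_restrict measurableSet_Ioi, hset, intervalIntegral.integral_of_le hs.2]

theorem separableSpace_Lp_restrict [SecondCountableTopology E] (s : Set ℝ) :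
    TopologicalSpace.SeparableSpace (Lp E 2 (volume.restrict s)) := by
  have : Fact ((2 : ENNReal) ≠ ⊤) := ⟨ENNReal.ofNat_ne_top⟩
  have : SecondCountableTopology (Lp E 2 (volume.restrict s)) := Lp.SecondCountableTopology
  infer_instance

variable [InnerProductSpace ℂ E]

theorem inner_toLp_toLp {u v : ℝ → E} (hab : a ≤ b) (hu : MemLp u 2 (volume.restrict (Icc a b)))
    (hv : MemLp v 2 (volume.restrict (Icc a b))) :
    ⟪hu.toLp u, hv.toLp v⟫_ℂ = ∫ x in a..b, ⟪u x, v x⟫_ℂ := by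
  rw [L2.inner_def, ← integral_restrict_Icc hab]
  refine integral_congr_ae ?_
  filter_upwards [hu.coeFn_toLp, hv.coeFn_toLp] with x hux hvx
  rw [hux, hvx]

theorem inner_toLp_right {u : ℝ → E} (hab : a ≤ b) (hu : MemLp u 2 (volume.restrict (Icc a b)))
    (g : Lp E 2 (volume.restrict (Icc a b))) : ⟪g, hu.toLp u⟫_ℂ = ∫ x in a..b, ⟪g x, u x⟫_ℂ := by
  simpa only [Lp.toLp_coeFn] using inner_toLp_toLp hab (Lp.memLp g) hu

theorem inner_toLp_left {u : ℝ → E} (hab : a ≤ b) (hu : MemLp u 2 (volume.restrict (Icc a b)))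
    (f : Lp E 2 (volume.restrict (Icc a b))) : ⟪hu.toLp u, f⟫_ℂ = ∫ x in a..b, ⟪u x, f x⟫_ℂ := by
  simpa only [Lp.toLp_coeFn] using inner_toLp_toLp hab hu (Lp.memLp f)

theorem intervalIntegrable_inner {u : ℝ → E} (hab : a ≤ b)
    (hu : MemLp u 2 (volume.restrict (Icc a b))) (g : Lp E 2 (volume.restrict (Icc a b))) :
    IntervalIntegrable (fun x => ⟪g x, u x⟫_ℂ) volume a b := by
  refine (intervalIntegrable_iff_integrableOn_Icc_of_le hab).2
    ((L2.integrable_inner (𝕜 := ℂ) g (hu.toLp u)).congr ?_)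
  filter_upwards [hu.coeFn_toLp] with x hx using congrArg (inner ℂ (g x)) hx

theorem continuousOn_clm_apply_const {Y : ℝ → E →L[ℂ] E} {S : Set ℝ} (hY : ContinuousOn Y S)
    (v : E) : ContinuousOn (fun x => Y x v) S :=
  hY.clm_apply continuousOn_const

theorem continuousOn_adjoint [CompleteSpace E] {Y : ℝ → E →L[ℂ] E} {S : Set ℝ}
    (hY : ContinuousOn Y S) : ContinuousOn (fun x => (Y x).adjoint) S :=
  ContinuousLinearMap.adjoint.continuous.comp_continuousOn hY

theorem inner_integral_clm_apply [CompleteSpace E] {Y : ℝ → E →L[ℂ] E} {f : ℝ → E}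
    (hY : ContinuousOn Y (uIcc a b)) (hf : IntervalIntegrable f volume a b) (v : E) :
    ⟪v, ∫ t in a..b, Y t (f t)⟫_ℂ = ∫ t in a..b, ⟪(Y t).adjoint v, f t⟫_ℂ := by
  have hcomm := (innerSL ℂ v).intervalIntegral_comp_comm (intervalIntegrable_apply_left hY hf)
  simp only [innerSL_apply_apply] at hcomm
  simp only [← hcomm, ContinuousLinearMap.adjoint_inner_left]

theorem integral_inner_clm_apply_eq_sum [CompleteSpace E] {ι : Type*} [Fintype ι]
    (e : OrthonormalBasis ι ℂ E) {Φ : ℝ → E →L[ℂ] E} {V : ℝ → E} (hab : a ≤ b)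
    (hΦ : ContinuousOn Φ (uIcc a b)) (hV : ContinuousOn V (uIcc a b))
    (g : Lp E 2 (volume.restrict (Icc a b))) :
    ∫ x in a..b, ⟪g x, Φ x (V x)⟫_ℂ =
      ∑ m, ∫ x in a..b, ⟪g x, Φ x (e m)⟫_ℂ * ⟪e m, V x⟫_ℂ := by
  rw [← intervalIntegral.integral_finsetSum fun m _ => ?_]
  · refine intervalIntegral.integral_congr fun x _ => ?_
    simp only [← ContinuousLinearMap.adjoint_inner_left, e.sum_inner_mul_inner]
  · exact (intervalIntegrable_inner hab
      (memLp_of_continuousOn (continuousOn_clm_apply_const hΦ (e m))) g).mul_continuousOn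
      (continuousOn_const.inner hV)

end SquareIntegrable

section IntegralForms

variable {E : Type*} [NormedAddCommGroup E] [InnerProductSpace ℂ E] {a b : ℝ}

/-- The form of the finite rank operator `f ↦ Φ ∫ Θ f` in `L²`. -/
noncomputable def separableForm (Φ Θ : ℝ → E →L[ℂ] E) (a b : ℝ) (g f : ℝ → E) : ℂ :=
  ∫ x in a..b, ⟪g x, Φ x (∫ t in a..b, Θ t (f t))⟫_ℂ

/-- The form of the iterated Volterra operator `f ↦ Φ(x) ∫ₓᵇ w(s) ∫ₛᵇ Θ(t) f(t) dt ds` in `L²`. -/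
noncomputable def volterraForm (Φ w Θ : ℝ → E →L[ℂ] E) (a b : ℝ) (g f : ℝ → E) : ℂ :=
  ∫ x in a..b, ⟪g x, Φ x (∫ s in x..b, w s (∫ t in s..b, Θ t (f t)))⟫_ℂ

theorem memLp_adjoint_apply [CompleteSpace E] {Θ : ℝ → E →L[ℂ] E}
    (hΘ : ContinuousOn Θ (uIcc a b)) (v : E) :
    MemLp (fun t => (Θ t).adjoint v) 2 (volume.restrict (Icc a b)) :=
  memLp_of_continuousOn (continuousOn_clm_apply_const (continuousOn_adjoint hΘ) v)

theorem intervalIntegrable_adjoint_apply [CompleteSpace E] {w : ℝ → E →L[ℂ] E}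
    (hw : IntervalIntegrable w volume a b) (v : E) :
    IntervalIntegrable (fun s => (w s).adjoint v) volume a b :=
  intervalIntegrable_clm_comp (((ContinuousLinearMap.apply ℂ E v).restrictScalars ℝ).comp
    (starL' ℝ (A := E →L[ℂ] E)).toContinuousLinearMap) hw

theorem inner_indicatorLp_Ioi [CompleteSpace E] {Θ : ℝ → E →L[ℂ] E}
    (hΘ : ContinuousOn Θ (uIcc a b)) (v : E) {s : ℝ} (hs : s ∈ Icc a b)
    (f : Lp E 2 (volume.restrict (Icc a b))) :
    ⟪indicatorLp (memLp_adjoint_apply hΘ v) (measurableSet_Ioi (a := s)), f⟫_ℂ =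
      ⟪v, ∫ t in s..b, Θ t (f t)⟫_ℂ := by
  have hsub : uIcc s b ⊆ uIcc a b := uIcc_subset_uIcc (Icc_subset_uIcc hs) right_mem_uIcc
  rw [inner_indicatorLp_left, setIntegral_Ioi_restrict_Icc _ hs, inner_integral_clm_apply
    (hΘ.mono hsub) ((intervalIntegrable_coeFn (hs.1.trans hs.2) f).mono_set hsub)]

theorem inner_indicatorLp_Iic {φ : ℝ → E} (hφ : MemLp φ 2 (volume.restrict (Icc a b))) {s : ℝ}
    (hs : s ∈ Icc a b) (g : Lp E 2 (volume.restrict (Icc a b))) :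
    ⟪g, indicatorLp hφ (measurableSet_Iic (a := s))⟫_ℂ = ∫ x in a..s, ⟪g x, φ x⟫_ℂ := by
  rw [inner_indicatorLp_right, setIntegral_Iic_restrict_Icc _ hs]

theorem norm_indicatorLp_adjoint_apply_le [CompleteSpace E] {Θ : ℝ → E →L[ℂ] E}
    (hΘ : ContinuousOn Θ (uIcc a b)) : ∃ c : ℝ, ∀ (v : E) (s : ℝ),
      ‖indicatorLp (memLp_adjoint_apply hΘ v) (measurableSet_Ioi (a := s))‖ ≤ c * ‖v‖ := by
  obtain ⟨c, hc⟩ := isCompact_uIcc.exists_bound_of_continuousOn (continuousOn_adjoint hΘ)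
  refine ⟨(measureUnivNNReal (volume.restrict (Icc a b)) : ℝ) ^ (2 : ENNReal).toReal⁻¹ * |c|,
    fun v s => (norm_indicatorLp_le _ _).trans ?_⟩
  rw [mul_assoc]
  refine Lp.norm_le_of_ae_bound (by positivity) ?_
  filter_upwards [(memLp_adjoint_apply hΘ v).coeFn_toLp, ae_restrict_mem measurableSet_Icc]
    with x hx hxab
  rw [hx]
  exact (Θ x).adjoint.le_of_opNorm_le ((hc x (Icc_subset_uIcc hxab)).trans (le_abs_self c)) v

theorem aestronglyMeasurable_inner_indicatorLp_Iic {φ : ℝ → E} (hab : a ≤ b)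
    (hφ : MemLp φ 2 (volume.restrict (Icc a b))) (g : Lp E 2 (volume.restrict (Icc a b))) :
    AEStronglyMeasurable (fun s => ⟪g, indicatorLp hφ (measurableSet_Iic (a := s))⟫_ℂ)
      (volume.restrict (Icc a b)) := by
  have hcont := (HasACDeriv.integral (intervalIntegrable_inner hab hφ g)
    left_mem_uIcc).continuousOn.mono Icc_subset_uIcc
  exact (hcont.congr fun s hs => inner_indicatorLp_Iic hφ hs g).aestronglyMeasurable
    measurableSet_Icc

theorem aestronglyMeasurable_inner_indicatorLp_Ioi [CompleteSpace E] {Θ : ℝ → E →L[ℂ] E}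
    {v : ℝ → E} (hab : a ≤ b) (hΘ : ContinuousOn Θ (uIcc a b))
    (hv : AEStronglyMeasurable v (volume.restrict (Icc a b)))
    (f : Lp E 2 (volume.restrict (Icc a b))) :
    AEStronglyMeasurable (fun s => ⟪indicatorLp (memLp_adjoint_apply hΘ (v s))
      (measurableSet_Ioi (a := s)), f⟫_ℂ) (volume.restrict (Icc a b)) := by
  have hcont := (HasACDeriv.integral_tail (intervalIntegrable_apply_left hΘ
    (intervalIntegrable_coeFn hab f)) right_mem_uIcc).continuousOn.mono Icc_subset_uIcc
  refine (hv.inner (hcont.aestronglyMeasurable measurableSet_Icc)).congr ?_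
  filter_upwards [ae_restrict_mem measurableSet_Icc] with s hs
  rw [inner_indicatorLp_Ioi hΘ (v s) hs]

theorem integral_inner_apply_integral_tail_eq [CompleteSpace E] {φ h : ℝ → E} (hab : a ≤ b)
    (hφ : MemLp φ 2 (volume.restrict (Icc a b))) (hh : IntervalIntegrable h volume a b) (v : E)
    (g : Lp E 2 (volume.restrict (Icc a b))) :
    ∫ x in a..b, ⟪g x, φ x⟫_ℂ * ⟪v, ∫ s in x..b, h s⟫_ℂ =
      ∫ s in a..b, (∫ x in a..s, ⟪g x, φ x⟫_ℂ) * ⟪v, h s⟫_ℂ := by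
  have hvh : IntervalIntegrable (fun s => ⟪v, h s⟫_ℂ) volume a b :=
    intervalIntegrable_clm_comp ((innerSL ℂ v).restrictScalars ℝ) hh
  refine Eq.trans (intervalIntegral.integral_congr fun x hx => ?_) (integral_bilin_integral_tail
    (ContinuousLinearMap.mul ℝ ℂ) (intervalIntegrable_inner hab hφ g) hvh)
  refine congrArg (⟪g x, φ x⟫_ℂ * ·) ?_
  exact ((innerSL ℂ v).intervalIntegral_comp_comm
    (hh.mono_set (uIcc_subset_uIcc hx right_mem_uIcc))).symm

theorem sum_inner_apply_apply_eq_trace_mul {ι : Type*} [Fintype ι] (e : OrthonormalBasis ι ℂ E)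
    (S T : E →L[ℂ] E) :
    ∑ m, ⟪e m, T (S (e m))⟫_ℂ = LinearMap.trace ℂ E (S * T : E →L[ℂ] E) := by
  classical
  rw [ContinuousLinearMap.toLinearMap_mul, LinearMap.trace_mul_comm,
    LinearMap.trace_eq_sum_inner _ e]
  rfl

variable [FiniteDimensional ℂ E] {Φ Θ w : ℝ → E →L[ℂ] E}

/- The trace vanishes because the two factors of the rank one operator at `s` live on `[a, s]` and
`(s, b]`. -/
theorem isNuclearForm_integral_mul_inner {φ v : ℝ → E} (hab : a ≤ b)
    (hφ : MemLp φ 2 (volume.restrict (Icc a b))) (hv : IntervalIntegrable v volume a b)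
    (hΘ : ContinuousOn Θ (uIcc a b)) :
    IsNuclearForm (fun g f : Lp E 2 (volume.restrict (Icc a b)) =>
      ∫ s in a..b, (∫ x in a..s, ⟪g x, φ x⟫_ℂ) * ⟪v s, ∫ t in s..b, Θ t (f t)⟫_ℂ) 0 := by
  have := FiniteDimensional.complete ℂ E
  have := FiniteDimensional.proper ℂ E
  have := separableSpace_Lp_restrict (E := E) (Icc a b)
  obtain ⟨c, hc⟩ := norm_indicatorLp_adjoint_apply_le hΘ
  let α (s : ℝ) := indicatorLp hφ (measurableSet_Iic (a := s))
  let κ (s : ℝ) := indicatorLp (memLp_adjoint_apply hΘ (v s)) (measurableSet_Ioi (a := s))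
  have hv' := (intervalIntegrable_iff_integrableOn_Icc_of_le hab).1 hv
  have hle (s) : ‖α s‖ * ‖κ s‖ ≤ ‖hφ.toLp φ‖ * c * ‖v s‖ := by
    rw [mul_assoc]
    gcongr
    exacts [norm_indicatorLp_le hφ _, hc (v s) s]
  have horth (s) : ⟪κ s, α s⟫_ℂ = 0 :=
    inner_indicatorLp_eq_zero_of_disjoint _ _ _ _ (Iic_disjoint_Ioi le_rfl).symm
  have hform := IsNuclearForm.integral (α := α) (κ := κ)
    (aestronglyMeasurable_inner_indicatorLp_Iic hab hφ)
    (aestronglyMeasurable_inner_indicatorLp_Ioi hab hΘ hv'.aestronglyMeasurable)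
    (hv'.norm.const_mul _) (.of_forall hle)
  simp only [horth, integral_zero] at hform
  convert hform using 3 with g f
  rw [← integral_restrict_Icc hab]
  refine integral_congr_ae ?_
  filter_upwards [ae_restrict_mem measurableSet_Icc] with s hs
  rw [inner_indicatorLp_Iic hφ hs, inner_indicatorLp_Ioi hΘ (v s) hs]

theorem isNuclearForm_volterraForm (hab : a ≤ b) (hΦ : ContinuousOn Φ (uIcc a b))
    (hw : IntervalIntegrable w volume a b) (hΘ : ContinuousOn Θ (uIcc a b)) :
    IsNuclearForm (fun g f : Lp E 2 (volume.restrict (Icc a b)) => volterraForm Φ w Θ a b g f)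
      0 := by
  have := FiniteDimensional.complete ℂ E
  let e := stdOrthonormalBasis ℂ E
  have hφ (m) : MemLp (fun x => Φ x (e m)) 2 (volume.restrict (Icc a b)) :=
    memLp_of_continuousOn (continuousOn_clm_apply_const hΦ (e m))
  have hv (m) := intervalIntegrable_adjoint_apply hw (e m)
  have hsum := IsNuclearForm.sum fun m (_ : m ∈ Finset.univ) =>
    isNuclearForm_integral_mul_inner hab (hφ m) (hv m) hΘ
  rw [Finset.sum_const_zero] at hsum
  convert hsum using 3 with g f
  have hτ := HasACDeriv.integral_tail (intervalIntegrable_apply_left hΘ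
    (intervalIntegrable_coeFn hab f)) right_mem_uIcc
  have hwτ := intervalIntegrable_apply_right hw hτ.continuousOn
  rw [volterraForm, integral_inner_clm_apply_eq_sum e hab hΦ
    (HasACDeriv.integral_tail hwτ right_mem_uIcc).continuousOn]
  refine Finset.sum_congr rfl fun m _ => ?_
  simp only [integral_inner_apply_integral_tail_eq hab (hφ m) hwτ,
    ContinuousLinearMap.adjoint_inner_left]

theorem isNuclearForm_separableForm (hab : a ≤ b) (hΦ : ContinuousOn Φ (uIcc a b))
    (hΘ : ContinuousOn Θ (uIcc a b)) :
    IsNuclearForm (fun g f : Lp E 2 (volume.restrict (Icc a b)) => separableForm Φ Θ a b g f)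
      (∫ x in a..b, LinearMap.trace ℂ E (Φ x * Θ x : E →L[ℂ] E)) := by
  have := FiniteDimensional.complete ℂ E
  let e := stdOrthonormalBasis ℂ E
  have hφ (m) : MemLp (fun x => Φ x (e m)) 2 (volume.restrict (Icc a b)) :=
    memLp_of_continuousOn (continuousOn_clm_apply_const hΦ (e m))
  have hθ (m) := memLp_adjoint_apply hΘ (e m)
  have hsum := IsNuclearForm.sum fun m (_ : m ∈ Finset.univ) =>
    IsNuclearForm.rankOne ((hφ m).toLp _) ((hθ m).toLp _)
  convert hsum using 1
  · ext g f
    rw [separableForm, integral_inner_clm_apply_eq_sum e hab hΦ continuousOn_const]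
    simp only [intervalIntegral.integral_mul_const, inner_toLp_right, inner_toLp_left, hab,
      inner_integral_clm_apply hΘ (intervalIntegrable_coeFn hab f)]
  · simp only [inner_toLp_toLp hab]
    rw [← intervalIntegral.integral_finsetSum]
    · refine intervalIntegral.integral_congr fun x _ => ?_
      simp only [ContinuousLinearMap.adjoint_inner_left]
      exact (sum_inner_apply_apply_eq_trace_mul e (Φ x) (Θ x)).symm
    · exact fun m _ => (((continuousOn_clm_apply_const (continuousOn_adjoint hΘ) (e m)).inner
        (continuousOn_clm_apply_const hΦ (e m))).intervalIntegrable)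

section Difference

variable {A₁ A₂ Φ₁ Φ₂ Ψ₁ Ψ₂ : ℝ → E →L[ℂ] E} {N₁ N₂ S : E →L[ℂ] E}
  {R₁ R₂ : Lp E 2 (volume.restrict (Icc a b)) →L[ℂ] Lp E 2 (volume.restrict (Icc a b))}

theorem inner_sub_apply_eq_of_ae_eq_greenSolution (hab : a ≤ b)
    (P₁ : IsFundamentalPair A₁ Φ₁ Ψ₁ a b) (P₂ : IsFundamentalPair A₂ Φ₂ Ψ₂ a b)
    {f : Lp E 2 (volume.restrict (Icc a b))}
    (hR₁ : R₁ f =ᵐ[volume.restrict (Icc a b)] greenSolution Φ₁ Ψ₁ N₁ a b fun x => S (f x))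
    (hR₂ : R₂ f =ᵐ[volume.restrict (Icc a b)] greenSolution Φ₂ Ψ₂ N₂ a b fun x => S (f x))
    (g : Lp E 2 (volume.restrict (Icc a b))) :
    ⟪g, (R₁ - R₂) f⟫_ℂ =
      separableForm (fun x => Φ₁ x * N₁) (fun t => Ψ₁ t * S) a b g f -
        separableForm (fun x => Φ₂ x * N₂) (fun t => Ψ₂ t * S) a b g f -
        volterraForm Φ₁ (transitionRate A₁ A₂ Ψ₁ Φ₂) (fun t => Ψ₂ t * S) a b g f := by
  have := FiniteDimensional.complete ℂ E
  have hh : IntervalIntegrable (fun x => S (f x)) volume a b :=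
    intervalIntegrable_clm_comp (S.restrictScalars ℝ) (intervalIntegrable_coeFn hab f)
  have hint {V : ℝ → E} {Y : ℝ → E →L[ℂ] E} (hY : ContinuousOn Y (uIcc a b))
      (hV : ContinuousOn V (uIcc a b)) :
      IntervalIntegrable (fun x => ⟪g x, Y x (V x)⟫_ℂ) volume a b :=
    intervalIntegrable_inner hab (memLp_of_continuousOn (hY.clm_apply hV)) g
  have hw := intervalIntegrable_apply_right (P₁.hasACDeriv_right_mul_left P₂).intervalIntegrable
    (P₂.hasACDeriv_integral_tail hh).continuousOn
  have h₁ := hint P₁.continuousOn_left (continuousOn_const (c := N₁ (∫ t in a..b, Ψ₁ t (S (f t)))))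
  have h₂ := hint P₂.continuousOn_left (continuousOn_const (c := N₂ (∫ t in a..b, Ψ₂ t (S (f t)))))
  have h₃ := hint P₁.continuousOn_left (HasACDeriv.integral_tail hw right_mem_uIcc).continuousOn
  refine Eq.trans ?_ ((intervalIntegral.integral_sub (h₁.sub h₂) h₃).trans
    (congrArg (· - _) (intervalIntegral.integral_sub h₁ h₂)))
  rw [L2.inner_def, ← integral_restrict_Icc hab]
  refine integral_congr_ae ?_
  filter_upwards [hR₁, hR₂, Lp.coeFn_sub (R₁ f) (R₂ f), ae_restrict_mem measurableSet_Icc]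
    with x hx₁ hx₂ hsub hx
  rw [sub_apply, hsub, Pi.sub_apply, hx₁, hx₂, ← inner_sub_right, ← inner_sub_right,
    P₁.greenSolution_sub_greenSolution P₂ N₁ N₂ hh (Icc_subset_uIcc hx)]

theorem isNuclearForm_inner_sub_of_ae_eq_greenSolution (hab : a ≤ b)
    (P₁ : IsFundamentalPair A₁ Φ₁ Ψ₁ a b) (P₂ : IsFundamentalPair A₂ Φ₂ Ψ₂ a b)
    (hR₁ : ∀ f, R₁ f =ᵐ[volume.restrict (Icc a b)] greenSolution Φ₁ Ψ₁ N₁ a b fun x => S (f x))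
    (hR₂ : ∀ f, R₂ f =ᵐ[volume.restrict (Icc a b)] greenSolution Φ₂ Ψ₂ N₂ a b fun x => S (f x)) :
    IsNuclearForm (fun g f => ⟪g, (R₁ - R₂) f⟫_ℂ)
      ((∫ x in a..b, LinearMap.trace ℂ E (Φ₁ x * N₁ * (Ψ₁ x * S) : E →L[ℂ] E)) -
        ∫ x in a..b, LinearMap.trace ℂ E (Φ₂ x * N₂ * (Ψ₂ x * S) : E →L[ℂ] E)) := by
  have hsep {A Φ Ψ : ℝ → E →L[ℂ] E} (P : IsFundamentalPair A Φ Ψ a b) (N : E →L[ℂ] E) :=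
    isNuclearForm_separableForm hab (Φ := fun x => Φ x * N) (Θ := fun t => Ψ t * S)
      (P.continuousOn_left.mul continuousOn_const) (P.continuousOn_right.mul continuousOn_const)
  have hvol := isNuclearForm_volterraForm hab (Θ := fun t => Ψ₂ t * S) P₁.continuousOn_left
    (P₁.hasACDeriv_right_mul_left P₂).intervalIntegrable
    (P₂.continuousOn_right.mul continuousOn_const)
  have hform := ((hsep P₁ N₁).sub (hsep P₂ N₂)).sub hvol
  rw [sub_zero] at hform
  convert hform using 3 with g f
  exact inner_sub_apply_eq_of_ae_eq_greenSolution hab P₁ P₂ (hR₁ f) (hR₂ f) g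

end Difference

end IntegralForms

section EuclideanMatrix

theorem eq_sum_smulRight_apply {E ι : Type*} [NormedAddCommGroup E] [InnerProductSpace ℂ E]
    [Fintype ι] (e : OrthonormalBasis ι ℂ E) (T : E →L[ℂ] E) :
    T = ∑ k, (innerSL ℂ (e k)).smulRight (T (e k)) := by
  ext v
  conv_lhs => rw [← e.sum_repr' v]
  simp [map_sum]

theorem HasACDeriv.of_apply_basis {E ι : Type*} [NormedAddCommGroup E] [InnerProductSpace ℂ E]
    [Fintype ι] (e : OrthonormalBasis ι ℂ E) {Y Y' : ℝ → E →L[ℂ] E} {a b : ℝ}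
    (h : ∀ k, HasACDeriv (fun x => Y x (e k)) (fun x => Y' x (e k)) a b) :
    HasACDeriv Y Y' a b := by
  have hsum := HasACDeriv.sum Finset.univ fun k _ => (h k).clm_comp
    ((ContinuousLinearMap.smulRightL ℂ E E (innerSL ℂ (e k))).restrictScalars ℝ)
  convert hsum using 2 with x x
  exacts [eq_sum_smulRight_apply e (Y x), eq_sum_smulRight_apply e (Y' x)]

variable {n : ℕ}

/-- The operator on `ℂⁿ` with a given matrix. -/
noncomputable abbrev matrixCLM : Matrix (Fin n) (Fin n) ℂ ≃⋆ₐ[ℂ] (Cn n →L[ℂ] Cn n) :=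
  Matrix.toEuclideanCLM

theorem matrixCLM_apply_basisFun (M : Matrix (Fin n) (Fin n) ℂ) (k : Fin n) :
    matrixCLM M (EuclideanSpace.basisFun (Fin n) ℂ k) = WithLp.toLp 2 (M.col k) := by
  rw [EuclideanSpace.basisFun_apply, ← Matrix.mulVec_single_one]
  rfl

theorem trace_matrixCLM (M : Matrix (Fin n) (Fin n) ℂ) :
    LinearMap.trace ℂ (Cn n) (matrixCLM M : Cn n →L[ℂ] Cn n) = M.trace := by
  rw [Matrix.coe_toEuclideanCLM_eq_toEuclideanLin, Matrix.toEuclideanLin_eq_toLin_orthonormal,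
    Matrix.trace_toLin_eq]

theorem intervalIntegrable_linearMap_comp {F : Type*} [NormedAddCommGroup F] [NormedSpace ℂ F]
    (L : Matrix (Fin n) (Fin n) ℂ →ₗ[ℂ] F) {Q : ℝ → Matrix (Fin n) (Fin n) ℂ}
    (hQ : IsL1Potential Q) : IntervalIntegrable (fun x => L (Q x)) volume 0 1 := by
  have hentries (M : Matrix (Fin n) (Fin n) ℂ) :
      L M = ∑ j, ∑ k, M j k • L (Matrix.single j k 1) := by
    conv_lhs => rw [Matrix.matrix_eq_sum_single M]
    simp only [map_sum, ← map_smul, Matrix.smul_single, smul_eq_mul, mul_one]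
  rw [intervalIntegrable_iff_integrableOn_Icc_of_le zero_le_one]
  simp only [hentries (Q _)]
  exact integrable_finsetSum _ fun j _ => integrable_finsetSum _ fun k _ => (hQ j k).smul_const _

theorem intervalIntegrable_matrixCLM {Q : ℝ → Matrix (Fin n) (Fin n) ℂ} (hQ : IsL1Potential Q) :
    IntervalIntegrable (fun x => matrixCLM (Q x)) volume 0 1 :=
  intervalIntegrable_linearMap_comp matrixCLM.toAlgEquiv.toLinearMap hQ

theorem continuousOn_entry {Y : ℝ → Matrix (Fin n) (Fin n) ℂ} {s : Set ℝ}
    (hY : ContinuousOn (fun x => matrixCLM (Y x)) s) (j k : Fin n) :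
    ContinuousOn (fun x => Y x j k) s := by
  have hcol := continuousOn_clm_apply_const hY (EuclideanSpace.basisFun (Fin n) ℂ k)
  simp only [matrixCLM_apply_basisFun] at hcol
  exact (EuclideanSpace.proj (𝕜 := ℂ) j).continuous.comp_continuousOn hcol

end EuclideanMatrix

section DiracSystem

variable {n : ℕ} {b : Fin n → ℂ} {Q : ℝ → Matrix (Fin n) (Fin n) ℂ} {z : ℂ} {u : ℝ → Cn n}

theorem ae_unitMeasure_iff {p : ℝ → Prop} :
    (∀ᵐ x ∂unitMeasure, p x) ↔ ∀ᵐ x, x ∈ uIcc (0 : ℝ) 1 → p x := by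
  rw [uIcc_of_le zero_le_one, ae_restrict_iff' measurableSet_Icc]

theorem IsW11.hasACDeriv (hu : IsW11 u) : HasACDeriv u (deriv u) 0 1 where
  ac := hu.1
  intervalIntegrable := (intervalIntegrable_iff_integrableOn_Icc_of_le zero_le_one).2 hu.2
  ae_hasDerivAt := ae_unitMeasure_iff.1 (hu.ae_differentiableAt.mono fun _ hx => hx.hasDerivAt)

theorem HasACDeriv.ae_deriv_eq {u' : ℝ → Cn n} (hu : HasACDeriv u u' 0 1) :
    deriv u =ᵐ[unitMeasure] u' :=
  (ae_unitMeasure_iff.2 hu.ae_hasDerivAt).mono fun _ hx => hx.deriv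

theorem HasACDeriv.isW11 {u' : ℝ → Cn n} (hu : HasACDeriv u u' 0 1) : IsW11 u :=
  ⟨hu.ac, Integrable.congr ((intervalIntegrable_iff_integrableOn_Icc_of_le zero_le_one).1
    hu.intervalIntegrable) hu.ae_deriv_eq.symm⟩

/-- The operator `iB`. -/
noncomputable def weight (b : Fin n → ℂ) : Cn n →L[ℂ] Cn n :=
  matrixCLM (Complex.I • Matrix.diagonal b)

/-- The coefficient `A = iB(z - Q)` in the form `y' = A y` of the equation `L(Q)y = z y`. -/
noncomputable def coefficient (b : Fin n → ℂ) (Q : ℝ → Matrix (Fin n) (Fin n) ℂ) (z : ℂ) (x : ℝ) :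
    Cn n →L[ℂ] Cn n :=
  weight b * (z • 1 - matrixCLM (Q x))

theorem intervalIntegrable_coefficient (b : Fin n → ℂ) (hQ : IsL1Potential Q) (z : ℂ) :
    IntervalIntegrable (coefficient b Q z) volume 0 1 :=
  (intervalIntegrable_const.sub (intervalIntegrable_matrixCLM hQ)).const_mul (weight b)

theorem smul_diagonal_mul_neg_smul_inv (hb : ∀ j, b j ≠ 0) :
    Complex.I • Matrix.diagonal b * (-Complex.I • (Matrix.diagonal b)⁻¹) = 1 := by
  have hdet : IsUnit (Matrix.diagonal b).det := by
    rw [Matrix.det_diagonal]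
    exact (Finset.prod_ne_zero_iff.2 fun j _ => hb j).isUnit
  rw [smul_mul_smul_comm, Matrix.mul_nonsing_inv _ hdet, mul_neg, Complex.I_mul_I, neg_neg,
    one_smul]

theorem diffExpr_eq_matrixCLM (x : ℝ) :
    diffExpr b Q u x =
      matrixCLM (-Complex.I • (Matrix.diagonal b)⁻¹) (deriv u x) + matrixCLM (Q x) (u x) := by
  rw [diffExpr, ← Matrix.smul_mulVec]
  rfl

theorem diffExpr_eq_iff (hb : ∀ j, b j ≠ 0) (x : ℝ) (v : Cn n) :
    diffExpr b Q u x = z • u x + v ↔ deriv u x = coefficient b Q z x (u x) + weight b v := by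
  have hmul := smul_diagonal_mul_neg_smul_inv hb
  have hweight_mul (w : Cn n) :
      weight b (matrixCLM (-Complex.I • (Matrix.diagonal b)⁻¹) w) = w := by
    rw [weight, ← mul_apply_eq_comp, ← map_mul, hmul, map_one, one_apply_eq_self]
  have hmul_weight (w : Cn n) :
      matrixCLM (-Complex.I • (Matrix.diagonal b)⁻¹) (weight b w) = w := by
    rw [weight, ← mul_apply_eq_comp, ← map_mul, mul_eq_one_comm.1 hmul, map_one, one_apply_eq_self]
  have hrhs : coefficient b Q z x (u x) + weight b v =
      weight b (z • u x + v - matrixCLM (Q x) (u x)) := by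
    simp only [coefficient, mul_apply_eq_comp, sub_apply, smul_apply, one_apply_eq_self, map_sub,
      map_add]
    abel
  rw [diffExpr_eq_matrixCLM, hrhs, ← eq_sub_iff_add_eq]
  constructor <;> intro h
  · rw [← h, hweight_mul]
  · rw [h, hmul_weight]

theorem IsW11.hasACDeriv_of_diffExpr (hb : ∀ j, b j ≠ 0) {f : ℝ → Cn n} (hu : IsW11 u)
    (h : ∀ᵐ x ∂unitMeasure, diffExpr b Q u x = z • u x + f x) :
    HasACDeriv u (fun x => coefficient b Q z x (u x) + weight b (f x)) 0 1 :=
  hu.hasACDeriv.congr_deriv <|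
    ae_unitMeasure_iff.1 (h.mono fun x hx => (diffExpr_eq_iff hb x (f x)).1 hx)

theorem HasACDeriv.ae_diffExpr_eq (hb : ∀ j, b j ≠ 0)
    (hu : HasACDeriv u (fun x => coefficient b Q z x (u x)) 0 1) :
    ∀ᵐ x ∂unitMeasure, diffExpr b Q u x = z • u x := by
  filter_upwards [hu.ae_deriv_eq] with x hx
  rw [← add_zero (z • u x), diffExpr_eq_iff hb, hx, map_zero, add_zero]

theorem exists_isFundamentalMatrix (hb : ∀ j, b j ≠ 0) (hQ : IsL1Potential Q) (z : ℂ) :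
    ∃ Φ, IsFundamentalMatrix b Q z Φ := by
  obtain ⟨Y, hY, hY0⟩ :=
    exists_hasACDeriv_mul_left (intervalIntegrable_coefficient b hQ z) zero_le_one
  refine ⟨fun x => matrixCLM.symm (Y x), by simp only [hY0, map_one], fun k => ?_⟩
  have hcol := hY.apply (HasACDeriv.const (EuclideanSpace.basisFun (Fin n) ℂ k))
  have hsymm (x : ℝ) : WithLp.toLp 2 ((matrixCLM.symm (Y x)).col k) =
      Y x (EuclideanSpace.basisFun (Fin n) ℂ k) := by
    rw [← matrixCLM_apply_basisFun, StarAlgEquiv.apply_symm_apply]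
  simp only [map_zero, zero_add, mul_apply_eq_comp] at hcol
  simp only [hsymm]
  exact ⟨hcol.isW11, hcol.ae_diffExpr_eq hb⟩

theorem IsFundamentalMatrix.exists_isFundamentalPair {Φ : ℝ → Matrix (Fin n) (Fin n) ℂ}
    (hΦ : IsFundamentalMatrix b Q z Φ) (hb : ∀ j, b j ≠ 0) (hQ : IsL1Potential Q) :
    ∃ Ψ, IsFundamentalPair (coefficient b Q z) (fun x => matrixCLM (Φ x)) Ψ 0 1 := by
  obtain ⟨Ψ, hΨ, hΨ0⟩ :=
    exists_hasACDeriv_neg_mul_right (intervalIntegrable_coefficient b hQ z) zero_le_one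
  refine ⟨Ψ, by rw [hΦ.1, map_one], hΨ0, .of_apply_basis (EuclideanSpace.basisFun (Fin n) ℂ)
    fun k => ?_, hΨ⟩
  obtain ⟨hW11, hde⟩ := hΦ.2 k
  simpa only [mul_apply_eq_comp, matrixCLM_apply_basisFun, map_zero, add_zero] using
    hW11.hasACDeriv_of_diffExpr hb (f := fun _ => 0) (by simpa only [add_zero] using hde)

namespace IsFundamentalPair

variable {A Ψ : ℝ → Cn n →L[ℂ] Cn n} {Φ : ℝ → Matrix (Fin n) (Fin n) ℂ} {x : ℝ}

theorem mul_matrixCLM_symm (P : IsFundamentalPair A (fun x => matrixCLM (Φ x)) Ψ 0 1)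
    (hx : x ∈ Icc (0 : ℝ) 1) : Φ x * matrixCLM.symm (Ψ x) = 1 := by
  rw [← uIcc_of_le zero_le_one] at hx
  apply matrixCLM.injective
  change matrixCLM (Φ x * matrixCLM.symm (Ψ x)) = matrixCLM 1
  rw [map_mul, map_one, StarAlgEquiv.apply_symm_apply]
  exact P.left_mul_right hx

theorem isUnit (P : IsFundamentalPair A (fun x => matrixCLM (Φ x)) Ψ 0 1)
    (hx : x ∈ Icc (0 : ℝ) 1) : IsUnit (Φ x) :=
  .of_mul_eq_one _ (P.mul_matrixCLM_symm hx)

theorem matrixCLM_inv (P : IsFundamentalPair A (fun x => matrixCLM (Φ x)) Ψ 0 1)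
    (hx : x ∈ Icc (0 : ℝ) 1) : matrixCLM (Φ x)⁻¹ = Ψ x := by
  rw [Matrix.inv_eq_right_inv (P.mul_matrixCLM_symm hx), StarAlgEquiv.apply_symm_apply]

end IsFundamentalPair

end DiracSystem

section TraceFormula

variable {n : ℕ} {b : Fin n → ℂ} {Q : ℝ → Matrix (Fin n) (Fin n) ℂ}
  {C D : Matrix (Fin n) (Fin n) ℂ} {z : ℂ}

theorem eq_zero_of_mem_resolventSetOf (hz : z ∈ resolventSetOf (bvpOperator b Q C D))
    {u : ℝ → Cn n} (hu : IsW11 u) (hde : ∀ᵐ x ∂unitMeasure, diffExpr b Q u x = z • u x)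
    (hbc : C *ᵥ (u 0).ofLp + D *ᵥ (u 1).ofLp = 0) : u 0 = 0 := by
  have hcont := hu.hasACDeriv.continuousOn
  have hmem : MemLp u 2 unitMeasure := by
    simpa only [uIcc_of_le zero_le_one] using memLp_of_continuousOn (p := 2) hcont
  have hgraph : (hmem.toLp u, z • hmem.toLp u) ∈ (bvpOperator b Q C D).graph := by
    rw [bvpOperator_graph]
    refine ⟨u, hmem.coeFn_toLp, hu, ?_, hbc⟩
    filter_upwards [hde, hmem.coeFn_toLp, Lp.coeFn_smul z (hmem.toLp u)] with x hx hux hzx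
    rw [hzx, Pi.smul_apply, hux, hx]
  obtain ⟨y, hy, hTy⟩ := (LinearPMap.mem_graph_iff _).1 hgraph
  have hzero : hmem.toLp u = 0 := by
    have hRy := (resolventOf_spec hz).2 y
    rw [hTy, hy, sub_self, map_zero] at hRy
    exact hRy.symm
  have hae : u =ᵐ[unitMeasure] 0 :=
    hmem.coeFn_toLp.symm.trans (hzero ▸ Lp.coeFn_zero (Cn n) 2 unitMeasure)
  rw [uIcc_of_le zero_le_one] at hcont
  exact Measure.eqOn_Icc_of_ae_eq volume zero_ne_one hae hcont continuousOn_const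
    (left_mem_Icc.2 zero_le_one)

theorem exists_solution_of_mem_resolventSetOf (hz : z ∈ resolventSetOf (bvpOperator b Q C D))
    (f : L2 n) :
    ∃ u : ℝ → Cn n, resolventOf (bvpOperator b Q C D) z f =ᵐ[unitMeasure] u ∧ IsW11 u ∧
      (∀ᵐ x ∂unitMeasure, diffExpr b Q u x = z • u x + f x) ∧
      C *ᵥ (u 0).ofLp + D *ᵥ (u 1).ofLp = 0 := by
  have hres := resolventOf_spec hz
  generalize resolventOf (bvpOperator b Q C D) z = R at hres ⊢
  obtain ⟨hmem, heq⟩ := hres.1 f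
  have hgraph : (R f, bvpOperator b Q C D ⟨R f, hmem⟩) ∈ bvpGraph b Q C D := by
    rw [← bvpOperator_graph]
    exact LinearPMap.mem_graph _ ⟨_, hmem⟩
  obtain ⟨u, hRu, hu, hde, hbc⟩ := hgraph
  refine ⟨u, hRu, hu, ?_, hbc⟩
  rw [sub_eq_iff_eq_add] at heq
  simp only [heq] at hde
  filter_upwards [hRu, hde, Lp.coeFn_add f (z • R f), Lp.coeFn_smul z (R f)]
    with x hRux hdex hadd hsmul
  rw [← hdex, hadd, Pi.add_apply, hsmul, Pi.smul_apply, hRux, add_comm]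

variable {Φ : ℝ → Matrix (Fin n) (Fin n) ℂ} {Ψ : ℝ → Cn n →L[ℂ] Cn n}

theorem isUnit_boundary (hb : ∀ j, b j ≠ 0)
    (P : IsFundamentalPair (coefficient b Q z) (fun x => matrixCLM (Φ x)) Ψ 0 1)
    (hz : z ∈ resolventSetOf (bvpOperator b Q C D)) : IsUnit (C + D * Φ 1) := by
  rw [← Matrix.mulVec_injective_iff_isUnit]
  refine (injective_iff_map_eq_zero (C + D * Φ 1).mulVecLin).2 fun c hc => ?_
  set u : ℝ → Cn n := fun x => matrixCLM (Φ x) (WithLp.toLp 2 c)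
  have hu : HasACDeriv u (fun x => coefficient b Q z x (u x)) 0 1 := by
    simpa only [map_zero, zero_add, mul_apply_eq_comp] using
      P.hasACDeriv_left.apply (.const (WithLp.toLp 2 c))
  have hu0 : u 0 = WithLp.toLp 2 c :=
    congrArg (fun T : Cn n →L[ℂ] Cn n => T (WithLp.toLp 2 c)) P.left_eq_one
  have hbc : C *ᵥ (u 0).ofLp + D *ᵥ (u 1).ofLp = 0 := by
    rw [← hc, hu0, Matrix.mulVecLin_apply, Matrix.add_mulVec, ← Matrix.mulVec_mulVec]
    rfl
  have hzero := eq_zero_of_mem_resolventSetOf hz hu.isW11 (hu.ae_diffExpr_eq hb) hbc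
  rw [hu0] at hzero
  simpa only [WithLp.toLp_eq_zero] using hzero

theorem resolventOf_ae_eq_greenSolution (hb : ∀ j, b j ≠ 0)
    (P : IsFundamentalPair (coefficient b Q z) (fun x => matrixCLM (Φ x)) Ψ 0 1)
    (hz : z ∈ resolventSetOf (bvpOperator b Q C D)) (f : L2 n) :
    resolventOf (bvpOperator b Q C D) z f =ᵐ[unitMeasure]
      greenSolution (fun x => matrixCLM (Φ x)) Ψ (matrixCLM ((C + D * Φ 1)⁻¹ * C)) 0 1
        fun x => weight b (f x) := by
  obtain ⟨u, hRu, hu, hde, hbc⟩ := exists_solution_of_mem_resolventSetOf hz f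
  have hinv : matrixCLM (C + D * Φ 1)⁻¹ * (matrixCLM C + matrixCLM D * matrixCLM (Φ 1)) = 1 := by
    rw [← map_mul, ← map_add, ← map_mul, Matrix.nonsing_inv_mul _
      ((Matrix.isUnit_iff_isUnit_det _).1 (isUnit_boundary hb P hz)), map_one]
  have hsource : IntervalIntegrable (fun x => weight b (f x)) volume 0 1 :=
    intervalIntegrable_clm_comp ((weight b).restrictScalars ℝ)
      (intervalIntegrable_coeFn zero_le_one f)
  filter_upwards [hRu, ae_restrict_mem measurableSet_Icc] with x hx hx01
  rw [← uIcc_of_le zero_le_one] at hx01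
  rw [hx, map_mul]
  exact P.eq_of_boundary hinv hsource (hu.hasACDeriv_of_diffExpr hb hde)
    (congrArg (WithLp.toLp 2) hbc) hx01

/-- The limit at `(x, x)` from `t < x` of the kernel `G(x, t)` of the resolvent of `L_{C,D}(Q)`,
where `Φ` is the fundamental matrix. -/
noncomputable def greenDiagonal (b : Fin n → ℂ) (C D : Matrix (Fin n) (Fin n) ℂ)
    (Φ : ℝ → Matrix (Fin n) (Fin n) ℂ) (x : ℝ) : Matrix (Fin n) (Fin n) ℂ :=
  Φ x * (C + D * Φ 1)⁻¹ * C * (Φ x)⁻¹ * (Complex.I • Matrix.diagonal b)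

theorem traceIntegrand_eq_sub (b : Fin n → ℂ) (C₁ D₁ C₂ D₂ : Matrix (Fin n) (Fin n) ℂ)
    (Φ₁ Φ₂ : ℝ → Matrix (Fin n) (Fin n) ℂ) (x : ℝ) :
    traceIntegrand b C₁ D₁ C₂ D₂ Φ₁ Φ₂ x =
      greenDiagonal b C₁ D₁ Φ₁ x - greenDiagonal b C₂ D₂ Φ₂ x :=
  Matrix.sub_mul _ _ _

theorem trace_matrixIntegral {F : ℝ → Matrix (Fin n) (Fin n) ℂ}
    (hF : ∀ j, IntervalIntegrable (fun x => F x j j) volume 0 1) :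
    (matrixIntegral F).trace = ∫ x in (0 : ℝ)..1, (F x).trace := by
  simp only [Matrix.trace, Matrix.diag_apply, matrixIntegral, Matrix.of_apply]
  exact (intervalIntegral.integral_finsetSum fun j _ => hF j).symm

section GreenDiagonal

variable {A : ℝ → Cn n →L[ℂ] Cn n}
  (P : IsFundamentalPair A (fun x => matrixCLM (Φ x)) Ψ 0 1)
  (b : Fin n → ℂ) (C D : Matrix (Fin n) (Fin n) ℂ)

include P

theorem IsFundamentalPair.matrixCLM_greenDiagonal {x : ℝ} (hx : x ∈ Icc (0 : ℝ) 1) :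
    matrixCLM (greenDiagonal b C D Φ x) =
      matrixCLM (Φ x) * matrixCLM ((C + D * Φ 1)⁻¹ * C) * (Ψ x * weight b) := by
  simp only [greenDiagonal, weight, ← P.matrixCLM_inv hx, map_mul, mul_assoc]

theorem IsFundamentalPair.intervalIntegrable_greenDiagonal (j k : Fin n) :
    IntervalIntegrable (fun x => greenDiagonal b C D Φ x j k) volume 0 1 := by
  refine (continuousOn_entry (ContinuousOn.congr (f := fun x =>
    matrixCLM (Φ x) * matrixCLM ((C + D * Φ 1)⁻¹ * C) * (Ψ x * weight b)) ?_ fun x hx => ?_)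
    j k).intervalIntegrable
  · exact (P.continuousOn_left.mul continuousOn_const).mul
      (P.continuousOn_right.mul continuousOn_const)
  · rw [uIcc_of_le zero_le_one] at hx
    exact P.matrixCLM_greenDiagonal b C D hx

theorem IsFundamentalPair.trace_matrixIntegral_greenDiagonal :
    (matrixIntegral (greenDiagonal b C D Φ)).trace =
      ∫ x in (0 : ℝ)..1, LinearMap.trace ℂ (Cn n)
        (matrixCLM (Φ x) * matrixCLM ((C + D * Φ 1)⁻¹ * C) * (Ψ x * weight b) :
          Cn n →L[ℂ] Cn n) := by
  rw [trace_matrixIntegral fun j => P.intervalIntegrable_greenDiagonal b C D j j]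
  refine intervalIntegral.integral_congr fun x hx => ?_
  rw [uIcc_of_le zero_le_one] at hx
  rw [← P.matrixCLM_greenDiagonal b C D hx, trace_matrixCLM]

end GreenDiagonal

section Difference

variable {Q₁ Q₂ Φ₁ Φ₂ : ℝ → Matrix (Fin n) (Fin n) ℂ} {Ψ₁ Ψ₂ : ℝ → Cn n →L[ℂ] Cn n}
  {C₁ D₁ C₂ D₂ : Matrix (Fin n) (Fin n) ℂ}

theorem intervalIntegrable_traceIntegrand {A₁ A₂ : ℝ → Cn n →L[ℂ] Cn n}
    (P₁ : IsFundamentalPair A₁ (fun x => matrixCLM (Φ₁ x)) Ψ₁ 0 1)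
    (P₂ : IsFundamentalPair A₂ (fun x => matrixCLM (Φ₂ x)) Ψ₂ 0 1) (j k : Fin n) :
    IntervalIntegrable (fun x => traceIntegrand b C₁ D₁ C₂ D₂ Φ₁ Φ₂ x j k) volume 0 1 := by
  simp only [traceIntegrand_eq_sub, Matrix.sub_apply]
  exact (P₁.intervalIntegrable_greenDiagonal b C₁ D₁ j k).sub
    (P₂.intervalIntegrable_greenDiagonal b C₂ D₂ j k)

theorem trace_matrixIntegral_traceIntegrand {A₁ A₂ : ℝ → Cn n →L[ℂ] Cn n}
    (P₁ : IsFundamentalPair A₁ (fun x => matrixCLM (Φ₁ x)) Ψ₁ 0 1)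
    (P₂ : IsFundamentalPair A₂ (fun x => matrixCLM (Φ₂ x)) Ψ₂ 0 1) :
    (matrixIntegral (traceIntegrand b C₁ D₁ C₂ D₂ Φ₁ Φ₂)).trace =
      (matrixIntegral (greenDiagonal b C₁ D₁ Φ₁)).trace -
        (matrixIntegral (greenDiagonal b C₂ D₂ Φ₂)).trace := by
  rw [← Matrix.trace_sub]
  congr 1
  ext j k
  simp only [matrixIntegral, Matrix.of_apply, Matrix.sub_apply, traceIntegrand_eq_sub]
  exact intervalIntegral.integral_sub (P₁.intervalIntegrable_greenDiagonal b C₁ D₁ j k)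
    (P₂.intervalIntegrable_greenDiagonal b C₂ D₂ j k)

theorem isNuclearForm_inner_resolventOf_sub (hb : ∀ j, b j ≠ 0)
    (P₁ : IsFundamentalPair (coefficient b Q₁ z) (fun x => matrixCLM (Φ₁ x)) Ψ₁ 0 1)
    (P₂ : IsFundamentalPair (coefficient b Q₂ z) (fun x => matrixCLM (Φ₂ x)) Ψ₂ 0 1)
    (hz₁ : z ∈ resolventSetOf (bvpOperator b Q₁ C₁ D₁))
    (hz₂ : z ∈ resolventSetOf (bvpOperator b Q₂ C₂ D₂)) :
    IsNuclearForm
      (fun g f => ⟪g, (resolventOf (bvpOperator b Q₁ C₁ D₁) z -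
        resolventOf (bvpOperator b Q₂ C₂ D₂) z) f⟫_ℂ)
      (matrixIntegral (traceIntegrand b C₁ D₁ C₂ D₂ Φ₁ Φ₂)).trace := by
  rw [trace_matrixIntegral_traceIntegrand P₁ P₂, P₁.trace_matrixIntegral_greenDiagonal,
    P₂.trace_matrixIntegral_greenDiagonal]
  exact isNuclearForm_inner_sub_of_ae_eq_greenSolution zero_le_one P₁ P₂
    (resolventOf_ae_eq_greenSolution hb P₁ hz₁) (resolventOf_ae_eq_greenSolution hb P₂ hz₂)

end Difference

end TraceFormula

end DiracBVP

theorem mainTheorem5 (n : ℕ) (b : Fin n → ℂ) (hb : ∀ j, b j ≠ 0)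
    (Q₁ Q₂ : ℝ → Matrix (Fin n) (Fin n) ℂ)
    (hQ₁ : DiracBVP.IsL1Potential Q₁) (hQ₂ : DiracBVP.IsL1Potential Q₂)
    (C₁ D₁ C₂ D₂ : Matrix (Fin n) (Fin n) ℂ)
    (hrank₁ : (Matrix.fromCols C₁ D₁).rank = n) (hrank₂ : (Matrix.fromCols C₂ D₂).rank = n)
    (z : ℂ)
    (hz₁ : z ∈ DiracBVP.resolventSetOf (DiracBVP.bvpOperator b Q₁ C₁ D₁))
    (hz₂ : z ∈ DiracBVP.resolventSetOf (DiracBVP.bvpOperator b Q₂ C₂ D₂)) :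
    DiracBVP.IsTraceClass
        (DiracBVP.resolventOf (DiracBVP.bvpOperator b Q₁ C₁ D₁) z -
          DiracBVP.resolventOf (DiracBVP.bvpOperator b Q₂ C₂ D₂) z) ∧
      (∃ Φ₁, DiracBVP.IsFundamentalMatrix b Q₁ z Φ₁) ∧
      (∃ Φ₂, DiracBVP.IsFundamentalMatrix b Q₂ z Φ₂) ∧
      ∀ Φ₁ Φ₂ : ℝ → Matrix (Fin n) (Fin n) ℂ,
        DiracBVP.IsFundamentalMatrix b Q₁ z Φ₁ → DiracBVP.IsFundamentalMatrix b Q₂ z Φ₂ →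
        -- all inverses and integrals in the trace formula are genuine
        (∀ x ∈ Set.Icc (0 : ℝ) 1, IsUnit (Φ₁ x) ∧ IsUnit (Φ₂ x)) ∧
        IsUnit (C₁ + D₁ * Φ₁ 1) ∧ IsUnit (C₂ + D₂ * Φ₂ 1) ∧
        (∀ j k, IntervalIntegrable
          (fun x => DiracBVP.traceIntegrand b C₁ D₁ C₂ D₂ Φ₁ Φ₂ x j k)
          MeasureTheory.volume 0 1) ∧
        DiracBVP.HasTrace
          (DiracBVP.resolventOf (DiracBVP.bvpOperator b Q₁ C₁ D₁) z -
            DiracBVP.resolventOf (DiracBVP.bvpOperator b Q₂ C₂ D₂) z)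
          (DiracBVP.matrixIntegral
            (DiracBVP.traceIntegrand b C₁ D₁ C₂ D₂ Φ₁ Φ₂)).trace := by
  obtain ⟨Φ₁, hΦ₁⟩ := DiracBVP.exists_isFundamentalMatrix hb hQ₁ z
  obtain ⟨Φ₂, hΦ₂⟩ := DiracBVP.exists_isFundamentalMatrix hb hQ₂ z
  obtain ⟨Ψ₁, P₁⟩ := hΦ₁.exists_isFundamentalPair hb hQ₁
  obtain ⟨Ψ₂, P₂⟩ := hΦ₂.exists_isFundamentalPair hb hQ₂
  refine ⟨(DiracBVP.isNuclearForm_inner_resolventOf_sub hb P₁ P₂ hz₁ hz₂).isTraceClass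
    fun _ _ => rfl, ⟨Φ₁, hΦ₁⟩, ⟨Φ₂, hΦ₂⟩, fun Φ₁ Φ₂ hΦ₁ hΦ₂ => ?_⟩
  obtain ⟨Ψ₁, P₁⟩ := hΦ₁.exists_isFundamentalPair hb hQ₁
  obtain ⟨Ψ₂, P₂⟩ := hΦ₂.exists_isFundamentalPair hb hQ₂
  exact ⟨fun x hx => ⟨P₁.isUnit hx, P₂.isUnit hx⟩, DiracBVP.isUnit_boundary hb P₁ hz₁,
    DiracBVP.isUnit_boundary hb P₂ hz₂, DiracBVP.intervalIntegrable_traceIntegrand P₁ P₂,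
    (DiracBVP.isNuclearForm_inner_resolventOf_sub hb P₁ P₂ hz₁ hz₂).hasTrace fun _ _ => rfl⟩
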